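/- Let $0<\alpha<1$, $T>0$, $r\ge 1$, let $p,m\ge 0$ and $d\ge1$ be integers, and let $\Omega\subset\mathbb R^d$ be a bounded open set (for instance a bounded Lipschitz domain, $d\in\{1,2,3\}$). Let $u_0\in L^2(\Omega)$ and $f\in L^2(0,T;L^2(\Omega))$. Write $\langle\cdot,\cdot\rangle$ and $\|\cdot\|$ for the inner product and norm of $L^2(\Omega)$, and $\omega_\beta(t)=t^{\beta-1}/\Gamma(\beta)$. For $a\ge 0$ let ${}_a\partial_t^\alpha v(t)=\frac{d}{dt}\int_a^t\omega_{1-\alpha}(t-s)v(s)\,ds$ be the Riemann–Liouville derivative, and $\partial_t^\alpha={}_0\partial_t^\alpha$. For $N\ge1$ let $t_n=(n/N)^rT$, $I_n=(t_{n-1},t_n]$, $\tau_n=t_n-t_{n-1}$. Let $S_h\subset H^1_0(\Omega)$ be the space of continuous piecewise polynomials of degree at most $m$ with respect to a conforming partition of $\overline\Omega$ into finitely many simplices that is quasi-uniform with constant $\kappa>0$ (each simplex contains a ball of radius $\kappa$ times the largest diameter of a simplex). Let $\mathcal P_p(S_h)$ be the polynomials in $t$ of degree at most $p$ with coefficients in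 $S_h$, and let $\mathcal W_h$ be the functions whose restriction to each $I_n$, $1\le n\le N$, belongs to $\mathcal P_p(S_h)$. The DG finite element solution is a function $U_h\in\mathcal W_h$ such that for $1\le n\le N$ $$\int_{I_n}\big[\langle\partial_t^\alpha U_h,X\rangle+\langle\nabla U_h,\nabla X\rangle\big]dt=\int_{I_n}\langle f+\omega_{1-\alpha}(t)u_0,X\rangle\,dt\qquad\forall X\in\mathcal P_p(S_h).$$ Let $\varepsilon>0$, $0<\delta\le t_1$, and let $w_j,\lambda_j\in\mathbb R$ $(1\le j\le Q)$ satisfy $$\omega_{-\alpha}(t)=\sum_{j=1}^Qw_je^{-\lambda_jt}+\widehat\varepsilon(t)\,\omega_{-\alpha}(t),\qquad |\widehat\varepsilon(t)|\le K\varepsilon,\qquad t\in[\delta,T],$$ with a constant $K>0$. The fast fully discrete solution is a function ${}_FU_h\in\mathcal W_h$ such that ${}_FU_h=U_h$ on $(0,t_2]\cap(0,T]$ and, for $3\le n\le N$ and all $X\in\mathcal P_p(S_h)$, $$\int_{I_n}\langle{}_{t_{n-2}}\partial_t^\alpha\,{}_FU_h,X\rangle\,dt+\sum_{j=1}^Qw_je^{-\lambda_j\tau_{n-1}}\langle\psi_j^n(X),Y_j(t_{n-2})\rangle+\int_{I_n}\langle\nabla\,{}_FU_h,\nabla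 X\rangle\,dt=\int_{I_n}\langle f+\omega_{1-\alpha}(t)u_0,X\rangle\,dt,$$ where $\psi^n_j(X)=\int_{I_n}e^{-\lambda_j(t-t_{n-1})}X(t)\,dt$ and $Y_j(t)=\int_0^te^{-\lambda_j(t-s)}{}_FU_h(s)\,ds$. Theorem. There are constants $c>0$ and $C>0$, which may depend on $\alpha,T,r,p,m,d,\Omega,f,u_0,\kappa,K$ but not on the partition of $\Omega$, $N$, $n$, $\varepsilon$, $\delta$, or the quadrature ($Q$, $w_j$, $\lambda_j$), such that whenever $\varepsilon\le cN^{-r\alpha}$, and $U_h$ and ${}_FU_h$ are as above, for all $1\le n\le N$ $$\int_0^{t_n}\|U_h(t)-{}_FU_h(t)\|^2dt\le C\,(\varepsilon t_n^\alpha t_1^{-\alpha})^2\qquad\text{and}\qquad(\varepsilon t_n^\alpha t_1^{-\alpha})^2\le C\,(\varepsilon n^{r\alpha})^2 .$$ -/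

import Mathlib

namespace FastDG

open MeasureTheory

/-! ### Spatial setting: `L²(Ω)`, `H¹₀(Ω)`, simplicial partitions, finite element spaces -/

/-- The Euclidean space `ℝᵈ`. -/
abbrev Space (d : ℕ) : Type := EuclideanSpace ℝ (Fin d)

/-- The space `L²(Ω)`. -/
abbrev L2 {d : ℕ} (Ω : Set (Space d)) : Type :=
  Lp ℝ 2 ((volume : Measure (Space d)).restrict Ω)

/-- The space `L²(Ω; ℝᵈ)` of square integrable vector fields. -/
abbrev L2Vec {d : ℕ} (Ω : Set (Space d)) : Type :=
  Lp (Space d) 2 ((volume : Measure (Space d)).restrict Ω)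

/-- Pairs `(v, g)` of a function and a vector field. An element of `H¹₀(Ω)` is represented by the
pair consisting of the function and its weak gradient. -/
abbrev FunGrad {d : ℕ} (Ω : Set (Space d)) : Type := L2 Ω × L2Vec Ω

/-- The pairs `(φ, ∇φ)` with `φ` a smooth function that is compactly supported in `Ω`. -/
def testPairs {d : ℕ} (Ω : Set (Space d)) : Set (FunGrad Ω) :=
  {w | ∃ φ : Space d → ℝ, ContDiff ℝ ((⊤ : ℕ∞) : WithTop ℕ∞) φ ∧ HasCompactSupport φ ∧
    tsupport φ ⊆ Ω ∧ w.1 =ᵐ[(volume : Measure (Space d)).restrict Ω] φ ∧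
    w.2 =ᵐ[(volume : Measure (Space d)).restrict Ω] gradient φ}

/-- The Sobolev space `H¹₀(Ω)`: the closure of the test functions in the `H¹` norm, each element
being recorded together with its weak gradient. -/
noncomputable def H10 {d : ℕ} (Ω : Set (Space d)) : Submodule ℝ (FunGrad Ω) :=
  (Submodule.span ℝ (testPairs Ω)).topologicalClosure

/-- The `d`-dimensional closed simplices (elements) of a simplicial complex in `ℝᵈ`,
given by their sets of vertices. -/
def cells {d : ℕ} (𝒯 : Geometry.SimplicialComplex ℝ (Space d)) : Set (Finset (Space d)) :=
  {s | s ∈ 𝒯.faces ∧ s.card = d + 1}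

/-- `𝒯` is a conforming partition of `Ω` into finitely many simplices (conformity is part of
being a simplicial complex), quasi-uniform with constant `κ`: every element contains a closed
ball whose radius is `κ` times the largest diameter of an element. -/
structure IsQuasiUniformPartition {d : ℕ} (κ : ℝ) (Ω : Set (Space d))
    (𝒯 : Geometry.SimplicialComplex ℝ (Space d)) : Prop where
  finite : 𝒯.faces.Finite
  cover : ⋃ s ∈ cells 𝒯, convexHull ℝ (s : Set (Space d)) = closure Ω
  quasiUniform : ∀ s ∈ cells 𝒯, ∀ s' ∈ cells 𝒯, ∃ x : Space d,
    Metric.closedBall x (κ * Metric.diam (convexHull ℝ (s' : Set (Space d)))) ⊆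
      convexHull ℝ (s : Set (Space d))

/-- `g` is continuous on the closure of `Ω` and agrees on each element of `𝒯` with a polynomial
(in `d` variables) of total degree at most `m`. -/
def IsContPiecewisePoly {d : ℕ} (m : ℕ) (Ω : Set (Space d))
    (𝒯 : Geometry.SimplicialComplex ℝ (Space d)) (g : Space d → ℝ) : Prop :=
  ContinuousOn g (closure Ω) ∧
  ∀ s ∈ cells 𝒯, ∃ P : MvPolynomial (Fin d) ℝ, P.totalDegree ≤ m ∧
    ∀ x ∈ convexHull ℝ (s : Set (Space d)), g x = MvPolynomial.eval (fun i => x i) P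

/-- The finite element space `S_h ⊆ H¹₀(Ω)`: the elements of `H¹₀(Ω)` that are continuous
piecewise polynomials of degree at most `m` with respect to `𝒯`. -/
noncomputable def feSpace {d : ℕ} (m : ℕ) (Ω : Set (Space d))
    (𝒯 : Geometry.SimplicialComplex ℝ (Space d)) : Submodule ℝ (FunGrad Ω) where
  carrier := {w | w ∈ H10 Ω ∧ ∃ g : Space d → ℝ, IsContPiecewisePoly m Ω 𝒯 g ∧
    w.1 =ᵐ[(volume : Measure (Space d)).restrict Ω] g}
  zero_mem' := by
    refine ⟨Submodule.zero_mem _, 0, ⟨continuousOn_const, fun s _ => ⟨0, by simp, by simp⟩⟩, ?_⟩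
    exact Lp.coeFn_zero _ _ _
  add_mem' := by
    rintro a b ⟨ha, g, ⟨hg, hgp⟩, hag⟩ ⟨hb, k, ⟨hk, hkp⟩, hbk⟩
    refine ⟨Submodule.add_mem _ ha hb, g + k, ⟨hg.add hk, fun s hs => ?_⟩, ?_⟩
    · obtain ⟨P, hP, hPe⟩ := hgp s hs
      obtain ⟨R, hR, hRe⟩ := hkp s hs
      refine ⟨P + R, (MvPolynomial.totalDegree_add P R).trans (max_le hP hR), fun x hx => ?_⟩
      simp [hPe x hx, hRe x hx]
    · exact (Lp.coeFn_add a.1 b.1).trans (hag.add hbk)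
  smul_mem' := by
    rintro c a ⟨ha, g, ⟨hg, hgp⟩, hag⟩
    refine ⟨Submodule.smul_mem _ c ha, c • g, ⟨hg.const_smul c, fun s hs => ?_⟩, ?_⟩
    · obtain ⟨P, hP, hPe⟩ := hgp s hs
      refine ⟨c • P, (MvPolynomial.totalDegree_smul_le c P).trans hP, fun x hx => ?_⟩
      simp [hPe x hx, MvPolynomial.smul_eval]
    · exact (Lp.coeFn_smul c a.1).trans (hag.const_smul c)

/-! ### Temporal setting: graded mesh, kernels, fractional derivatives, trial functions -/

/-- The graded time grid `t_n = (n / N)^r T`. -/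
noncomputable def grid (T r : ℝ) (N n : ℕ) : ℝ := ((n : ℝ) / (N : ℝ)) ^ r * T

/-- The kernel `ω_β(t) = t^(β-1) / Γ(β)`. -/
noncomputable def kern (β t : ℝ) : ℝ := t ^ (β - 1) / Real.Gamma β

/-- The fractional integral of order `β > 0` with lower terminal `a`:
`∫_a^t ω_β(t-s) u(s) ds`. -/
noncomputable def fracInt {V : Type*} [NormedAddCommGroup V] [NormedSpace ℝ V]
    (a β : ℝ) (u : ℝ → V) (t : ℝ) : V :=
  ∫ s in a..t, kern β (t - s) • u s

/-- The Riemann--Liouville derivative of order `α ∈ (0,1)` with lower terminal `a`. -/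
noncomputable def rlDeriv {V : Type*} [NormedAddCommGroup V] [NormedSpace ℝ V]
    (a α : ℝ) (u : ℝ → V) (t : ℝ) : V :=
  deriv (fracInt a (1 - α) u) t

/-- `v` coincides on the set `I` with a polynomial in time of degree at most `p` with
coefficients in `S`. -/
def IsTimePolyOn {V : Type*} [AddCommGroup V] [Module ℝ V]
    (p : ℕ) (S : Submodule ℝ V) (I : Set ℝ) (v : ℝ → V) : Prop :=
  ∃ a : ℕ → V, (∀ k, a k ∈ S) ∧ ∀ t ∈ I, v t = ∑ k ∈ Finset.range (p + 1), t ^ k • a k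

/-- The trial space: on each interval `(t_{n-1}, t_n]`, `1 ≤ n ≤ N`, the function is a polynomial
in time of degree at most `p` with coefficients in `S`. -/
def IsTrial {V : Type*} [AddCommGroup V] [Module ℝ V]
    (T r : ℝ) (N p : ℕ) (S : Submodule ℝ V) (v : ℝ → V) : Prop :=
  ∀ n : ℕ, 1 ≤ n → n ≤ N → IsTimePolyOn p S (Set.Ioc (grid T r N (n - 1)) (grid T r N n)) v

/-! ### The discontinuous Galerkin finite element method -/

/-- The right-hand side `∫_{I_n} ⟨f + ω_{1-α}(t) u₀, X⟩ dt` of both schemes. -/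
noncomputable def loadForm {d : ℕ} {Ω : Set (Space d)} (α T r : ℝ) (N : ℕ) (f : ℝ → L2 Ω)
    (u₀ : L2 Ω) (n : ℕ) (X : ℝ → FunGrad Ω) : ℝ :=
  ∫ t in grid T r N (n - 1)..grid T r N n, inner ℝ (f t + kern (1 - α) t • u₀) (X t).1

/-- `U` is a solution of the DG finite element method with finite element space `S`:
for all `1 ≤ n ≤ N` and all polynomials `X` of degree at most `p` with coefficients in `S`,
`∫_{I_n} [⟨∂_t^α U, X⟩ + ⟨∇U, ∇X⟩] dt = ∫_{I_n} ⟨f + ω_{1-α}(t) u₀, X⟩ dt`. -/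
def IsDGSolution {d : ℕ} {Ω : Set (Space d)} (α T r : ℝ) (N p : ℕ)
    (S : Submodule ℝ (FunGrad Ω)) (f : ℝ → L2 Ω) (u₀ : L2 Ω) (U : ℝ → FunGrad Ω) : Prop :=
  IsTrial T r N p S U ∧
  ∀ n : ℕ, 1 ≤ n → n ≤ N → ∀ X : ℝ → FunGrad Ω,
    IsTimePolyOn p S (Set.Ioc (grid T r N (n - 1)) (grid T r N n)) X →
    ∫ t in grid T r N (n - 1)..grid T r N n,
        (inner ℝ (rlDeriv 0 α (fun s => (U s).1) t) (X t).1 + inner ℝ (U t).2 (X t).2) =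
      loadForm α T r N f u₀ n X

/-! ### The fast method -/

/-- Exponential sum approximation of `ω_{-α}` on `[δ, T]`:
`ω_{-α}(t) = ∑_j w_j e^{-λ_j t} + ε̂(t) ω_{-α}(t)` with relative error `|ε̂(t)| ≤ η`. -/
def IsKernelApprox (α δ T η : ℝ) {Q : ℕ} (w lam : Fin Q → ℝ) : Prop :=
  ∃ εhat : ℝ → ℝ, ∀ t ∈ Set.Icc δ T, |εhat t| ≤ η ∧
    kern (-α) t = ∑ j, w j * Real.exp (-(lam j) * t) + εhat t * kern (-α) t

/-- The local part `∫_{I_n} ⟨_{t_{n-2}}∂_t^α U, X⟩ dt`, for `n ≥ 2`. -/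
noncomputable def localForm {d : ℕ} {Ω : Set (Space d)} (α T r : ℝ) (N n : ℕ)
    (U X : ℝ → FunGrad Ω) : ℝ :=
  ∫ t in grid T r N (n - 1)..grid T r N n,
    inner ℝ (rlDeriv (grid T r N (n - 2)) α (fun s => (U s).1) t) (X t).1

/-- The history variable `Y(t) = ∫_0^t e^{-l(t-s)} U(s) ds`, which solves
`Y' = -l Y + U`, `Y(0) = 0`. -/
noncomputable def histVar {d : ℕ} {Ω : Set (Space d)} (l : ℝ) (U : ℝ → FunGrad Ω) (t : ℝ) :
    L2 Ω :=
  ∫ s in (0 : ℝ)..t, Real.exp (-l * (t - s)) • (U s).1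

/-- The weighted moment `ψⁿ(X) = ∫_{I_n} e^{-l(t-t_{n-1})} X(t) dt`. -/
noncomputable def psiForm {d : ℕ} {Ω : Set (Space d)} (T r : ℝ) (N n : ℕ) (l : ℝ)
    (X : ℝ → FunGrad Ω) : L2 Ω :=
  ∫ t in grid T r N (n - 1)..grid T r N n, Real.exp (-l * (t - grid T r N (n - 1))) • (X t).1

/-- The fast history part `∑_j w_j e^{-λ_j τ_{n-1}} ⟨ψⁿ_j(X), Y_j(t_{n-2})⟩`, for `n ≥ 2`, where
`τ_{n-1} = t_{n-1} - t_{n-2}`. -/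
noncomputable def fastHistForm {d : ℕ} {Ω : Set (Space d)} (T r : ℝ) (N n : ℕ) {Q : ℕ}
    (w lam : Fin Q → ℝ) (U X : ℝ → FunGrad Ω) : ℝ :=
  ∑ j, w j * Real.exp (-(lam j) * (grid T r N (n - 1) - grid T r N (n - 2))) *
    inner ℝ (psiForm T r N n (lam j) X) (histVar (lam j) U (grid T r N (n - 2)))

/-- `UF` is a solution of the fast fully discrete DG method started from `U`: it belongs to the
trial space, agrees with `U` on `(0, t_2]` and satisfies, on each later time interval,
`L^{α,n}(UF, X) + H_F^{α,n}(UF, X) + ∫_{I_n} ⟨∇UF, ∇X⟩ dt = ∫_{I_n} ⟨f + ω_{1-α}(t) u₀, X⟩ dt`. -/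
def IsFastDGSolution {d : ℕ} {Ω : Set (Space d)} (α T r : ℝ) (N p : ℕ)
    (S : Submodule ℝ (FunGrad Ω)) (f : ℝ → L2 Ω) (u₀ : L2 Ω) {Q : ℕ} (w lam : Fin Q → ℝ)
    (U UF : ℝ → FunGrad Ω) : Prop :=
  IsTrial T r N p S UF ∧
  (∀ t ∈ Set.Ioc 0 (grid T r N 2), t ≤ T → UF t = U t) ∧
  ∀ n : ℕ, 3 ≤ n → n ≤ N → ∀ X : ℝ → FunGrad Ω,
    IsTimePolyOn p S (Set.Ioc (grid T r N (n - 1)) (grid T r N n)) X →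
    localForm α T r N n UF X + fastHistForm T r N n w lam UF X +
        ∫ t in grid T r N (n - 1)..grid T r N n, inner ℝ (UF t).2 (X t).2 =
      loadForm α T r N f u₀ n X

end FastDG

namespace FastDG

open MeasureTheory Set Filter Topology

/-! Write `e = u - z` for the difference of the exact and the fast DG solutions. Composing the
exponentials in the fast history gives the remote history of `z` with kernel `∑ w_j exp(-λ_j x)` in
place of `ω_{-α}`. The fast scheme is therefore the exact scheme plus a perturbation with kernel `ρ
= ∑ w_j exp(-λ_j x) - ω_{-α}`. The grading makes every step at least `t_1 ≥ δ`, so only arguments in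
`[t_1, T]` occur, and there `|ρ| ≤ σ |ω_{-α}|` with `σ = K ε`. Testing the difference of the schemes
with `e` and dropping the nonnegative gradient term leaves `∫ ⟨∂^α e, e⟩ ≤ ∫ ⟨∫ ρ z, e⟩` on each
interval.

The left side is coercive. Pointwise `2 ⟨∂^α v, v⟩ ≥ ∂^α ‖v‖² + ω_{1-α} ‖v‖²`
(`rlDeriv_norm_sq_le`), hence `∫_0^{t_n} ⟨∂^α e, e⟩ ≥ ω_{1-α}(t_n) ∫_0^{t_n} ‖e‖²`.

The right side is treated by Young's inequality with a weight `η` under the history integral. Since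
`-ω_{-α}` is minus the derivative of `ω_{1-α}`, integrating over a time interval turns the `‖z‖²`
part into a difference of two `ω_{1-α}` convolutions, and these telescope
(`integral_rlDeriv_error_le`). The sum is at most `σ/2 · ω_{1-α}(t_1) (η ∫ ‖z‖² + η⁻¹ ∫ ‖e‖²)`.

With `q = σ (t_n/t_1)^α` one has `σ ω_{1-α}(t_1) = q ω_{1-α}(t_n)`, and `η = q` yields `∫ ‖e‖² ≤ q²
∫ ‖z‖²`. For `q ≤ 1/2`, replacing `z` by `u - e` and absorbing gives `∫ ‖e‖² ≤ 4 q² ∫ ‖u‖²`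
(`error_norm_sq_le`). The same coercivity bounds `∫ ‖u‖²` by the data (`norm_sq_le_of_energy_le`).
Space enters only through the fact that `e` and `u` are admissible test functions, so no constant
depends on the partition. -/

/-! ### Piecewise polynomials in time -/

/-- The functions vanishing on the negative half line that are piecewise polynomial on finitely many
intervals that are open on the left and closed on the right. -/
def pwPoly (E : Type*) [AddCommGroup E] [Module ℝ E] : Submodule ℝ (ℝ → E) :=
  Submodule.span ℝ {w | ∃ (a : ℝ) (q : Polynomial ℝ) (A : E), 0 ≤ a ∧
    w = (Ioi a).indicator fun s => q.eval s • A}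

section Algebra

variable {E F : Type*} [AddCommGroup E] [Module ℝ E] [AddCommGroup F] [Module ℝ F]

theorem indicator_Ioi_mem_pwPoly {a : ℝ} (ha : 0 ≤ a) (q : Polynomial ℝ) (A : E) :
    (Ioi a).indicator (fun s => q.eval s • A) ∈ pwPoly E :=
  Submodule.subset_span ⟨a, q, A, ha, rfl⟩

theorem indicator_const_mem_pwPoly (A : E) : (Ioi (0 : ℝ)).indicator (fun _ => A) ∈ pwPoly E := by
  simpa using indicator_Ioi_mem_pwPoly le_rfl (1 : Polynomial ℝ) A

theorem pwPoly_map {v : ℝ → E} (hv : v ∈ pwPoly E) (L : E →ₗ[ℝ] F) :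
    (fun s => L (v s)) ∈ pwPoly F := by
  induction hv using Submodule.span_induction with
  | mem x hx =>
    obtain ⟨a, q, A, ha, rfl⟩ := hx
    convert indicator_Ioi_mem_pwPoly ha q (L A) using 1
    ext s
    by_cases h : s ∈ Ioi a <;> simp [h]
  | zero => convert (pwPoly F).zero_mem using 1; ext; simp
  | add x y _ _ hx hy => convert (pwPoly F).add_mem hx hy using 1; ext; simp
  | smul c x _ hx => convert (pwPoly F).smul_mem c hx using 1; ext; simp

theorem indicator_Ioc_mem_pwPoly {a b : ℝ} (ha : 0 ≤ a) (hab : a ≤ b) (q : Polynomial ℝ) (A : E) :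
    (Ioc a b).indicator (fun s => q.eval s • A) ∈ pwPoly E := by
  convert (pwPoly E).sub_mem (indicator_Ioi_mem_pwPoly ha q A)
    (indicator_Ioi_mem_pwPoly (ha.trans hab) q A) using 1
  ext s
  by_cases h : a < s <;> by_cases h' : b < s
  · simp [h, h', not_le.2 h']
  · simp [h, h', not_lt.1 h']
  · exact absurd (hab.trans_lt h') h
  · simp [h, h']

end Algebra

section Normed

variable {E : Type*} [NormedAddCommGroup E]

theorem pwPoly_stronglyMeasurable [NormedSpace ℝ E] {v : ℝ → E} (hv : v ∈ pwPoly E) :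
    StronglyMeasurable v := by
  induction hv using Submodule.span_induction with
  | mem x hx =>
    obtain ⟨a, q, A, ha, rfl⟩ := hx
    refine StronglyMeasurable.indicator ?_ measurableSet_Ioi
    exact (q.continuous.smul continuous_const).stronglyMeasurable
  | zero => exact stronglyMeasurable_zero
  | add x y _ _ hx hy => exact hx.add hy
  | smul c x _ hx => exact hx.const_smul c

theorem pwPoly_bounded [NormedSpace ℝ E] {v : ℝ → E} (hv : v ∈ pwPoly E) (L : ℝ) :
    ∃ C, 0 ≤ C ∧ ∀ s ∈ Icc (-L) L, ‖v s‖ ≤ C := by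
  induction hv using Submodule.span_induction with
  | mem x hx =>
    obtain ⟨a, q, A, ha, rfl⟩ := hx
    obtain ⟨C, hC⟩ := (isCompact_Icc (a := -L) (b := L)).exists_bound_of_continuousOn
      (q.continuous.smul (continuous_const (y := A))).continuousOn
    exact ⟨max C 0, le_max_right _ _, fun s hs =>
      (norm_indicator_le_norm_self _ _).trans ((hC s hs).trans (le_max_left _ _))⟩
  | zero => exact ⟨0, le_rfl, by simp⟩
  | add x y _ _ hx hy =>
    obtain ⟨C, h0, hC⟩ := hx
    obtain ⟨D, h1, hD⟩ := hy
    exact ⟨C + D, by positivity, fun s hs => (norm_add_le _ _).trans (add_le_add (hC s hs) (hD s hs))⟩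
  | smul c x _ hx =>
    obtain ⟨C, h0, hC⟩ := hx
    refine ⟨|c| * C, by positivity, fun s hs => ?_⟩
    rw [Pi.smul_apply, norm_smul, Real.norm_eq_abs]
    exact mul_le_mul_of_nonneg_left (hC s hs) (abs_nonneg _)

theorem pwPoly_differentiableAt [NormedSpace ℝ E] {v : ℝ → E} (hv : v ∈ pwPoly E) :
    ∃ S : Set ℝ, S.Finite ∧ ∀ t ∉ S, DifferentiableAt ℝ v t := by
  induction hv using Submodule.span_induction with
  | mem x hx =>
    obtain ⟨a, q, A, ha, rfl⟩ := hx
    refine ⟨{a}, finite_singleton a, fun t ht => ?_⟩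
    rcases lt_or_gt_of_ne (show t ≠ a from ht) with h | h
    · refine (differentiableAt_const (0 : E)).congr_of_eventuallyEq ?_
      filter_upwards [Iio_mem_nhds h] with s hs
      exact indicator_of_notMem (not_lt.2 (le_of_lt (mem_Iio.1 hs))) _
    · refine (q.differentiable.differentiableAt.smul_const A).congr_of_eventuallyEq ?_
      filter_upwards [Ioi_mem_nhds h] with s hs
      exact indicator_of_mem hs _
  | zero => exact ⟨∅, finite_empty, fun t _ => differentiableAt_const _⟩
  | add x y _ _ hx hy =>
    obtain ⟨S, hS, hx⟩ := hx
    obtain ⟨R, hR, hy⟩ := hy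
    exact ⟨S ∪ R, hS.union hR, fun t ht =>
      (hx t fun h => ht (Or.inl h)).add (hy t fun h => ht (Or.inr h))⟩
  | smul c x _ hx =>
    obtain ⟨S, hS, hx⟩ := hx
    exact ⟨S, hS, fun t ht => (hx t ht).const_smul c⟩

/-- A piecewise polynomial is bounded on bounded sets, so `k` only has to be integrable. This admits
the weakly singular kernels. -/
theorem pwPoly_smul_intervalIntegrable [NormedSpace ℝ E] {v : ℝ → E} (hv : v ∈ pwPoly E)
    {k : ℝ → ℝ} {a b : ℝ} (hk : IntervalIntegrable k volume a b) :
    IntervalIntegrable (fun s => k s • v s) volume a b := by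
  obtain ⟨C, -, hC⟩ := pwPoly_bounded hv (max |a| |b|)
  rw [intervalIntegrable_iff] at hk ⊢
  refine hk.smul_bdd C (pwPoly_stronglyMeasurable hv).aestronglyMeasurable ?_
  refine (ae_restrict_iff' measurableSet_uIoc).2 (Eventually.of_forall fun s hs => hC s ?_)
  rw [uIoc, mem_Ioc] at hs
  rw [mem_Icc, ← abs_le]
  rcases abs_cases s with h | h <;> rcases abs_cases a with ha | ha <;>
    rcases abs_cases b with hb | hb <;> rcases le_total a b with hab | hab <;>
    simp only [hab, min_eq_left, max_eq_right, min_eq_right, max_eq_left] at hs <;>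
    simp only [le_max_iff] <;> first | (left; linarith) | (right; linarith)

theorem pwPoly_intervalIntegrable [NormedSpace ℝ E] {v : ℝ → E} (hv : v ∈ pwPoly E) (a b : ℝ) :
    IntervalIntegrable v volume a b := by
  simpa using pwPoly_smul_intervalIntegrable hv (k := fun _ => 1) (a := a) (b := b)
    intervalIntegrable_const

theorem pwPoly_inner [InnerProductSpace ℝ E] {v w : ℝ → E} (hv : v ∈ pwPoly E)
    (hw : w ∈ pwPoly E) : (fun s => inner ℝ (v s) (w s)) ∈ pwPoly ℝ := by
  induction hv, hw using Submodule.span_induction₂ with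
  | mem_mem x y hx hy =>
    obtain ⟨a, q, A, ha, rfl⟩ := hx
    obtain ⟨b, q', B, hb, rfl⟩ := hy
    convert indicator_Ioi_mem_pwPoly (ha.trans (le_max_left a b)) (q * q') (inner ℝ A B) using 1
    ext s
    by_cases h : a < s <;> by_cases h' : b < s <;>
      simp [h, h', inner_smul_left, inner_smul_right, indicator]
    ring
  | zero_left y hy => convert (pwPoly ℝ).zero_mem using 1; ext; simp
  | zero_right y hy => convert (pwPoly ℝ).zero_mem using 1; ext; simp
  | add_left x y z _ _ _ hx hy =>
    convert (pwPoly ℝ).add_mem hx hy using 1; ext; simp [inner_add_left]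
  | add_right x y z _ _ _ hx hy =>
    convert (pwPoly ℝ).add_mem hx hy using 1; ext; simp [inner_add_right]
  | smul_left r x y _ _ h =>
    convert (pwPoly ℝ).smul_mem r h using 1; ext; simp [inner_smul_left]
  | smul_right r x y _ _ h =>
    convert (pwPoly ℝ).smul_mem r h using 1; ext; simp [inner_smul_right]

theorem pwPoly_norm_sq [InnerProductSpace ℝ E] {v : ℝ → E} (hv : v ∈ pwPoly E) :
    (fun s => ‖v s‖ ^ 2) ∈ pwPoly ℝ := by
  simpa only [real_inner_self_eq_norm_sq] using pwPoly_inner hv hv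

/-- The product of an integrable function with a piecewise polynomial is integrable. -/
theorem pwPoly_inner_intervalIntegrable [InnerProductSpace ℝ E] {D w : ℝ → E} {a b : ℝ}
    (hD : IntervalIntegrable D volume a b) (hw : w ∈ pwPoly E) :
    IntervalIntegrable (fun s => inner ℝ (D s) (w s)) volume a b := by
  induction hw using Submodule.span_induction with
  | mem x hx =>
    obtain ⟨c, q, A, hc, rfl⟩ := hx
    have h1 : IntervalIntegrable (fun s => inner ℝ A (D s)) volume a b := by
      rw [intervalIntegrable_iff] at hD ⊢
      exact hD.const_inner A
    have h2 := h1.mul_continuousOn (g := fun s => q.eval s) q.continuous.continuousOn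
    rw [intervalIntegrable_iff] at h2 ⊢
    convert h2.indicator (measurableSet_Ioi (a := c)) using 1
    ext s
    by_cases h : c < s <;> simp [h, inner_smul_right, real_inner_comm, mul_comm]
  | zero => simp
  | add x y _ _ hx hy => simpa [inner_add_right] using hx.add hy
  | smul r x _ h => simpa [inner_smul_right] using h.const_mul r

end Normed

section

/-! ### Fractional integrals of piecewise polynomials -/

theorem kern_nonneg {β : ℝ} (hβ : 0 < β) {t : ℝ} (ht : 0 ≤ t) : 0 ≤ kern β t :=
  div_nonneg (Real.rpow_nonneg ht _) (Real.Gamma_pos_of_pos hβ).le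

theorem kern_pos {β : ℝ} (hβ : 0 < β) {t : ℝ} (ht : 0 < t) : 0 < kern β t :=
  div_pos (Real.rpow_pos_of_pos ht _) (Real.Gamma_pos_of_pos hβ)

theorem kern_antitone {β : ℝ} (hβ : 0 < β) (hβ1 : β ≤ 1) {s t : ℝ} (hs : 0 < s) (hst : s ≤ t) :
    kern β t ≤ kern β s :=
  div_le_div_of_nonneg_right (Real.rpow_le_rpow_of_nonpos hs hst (by linarith))
    (Real.Gamma_pos_of_pos hβ).le

theorem kern_intervalIntegrable {β : ℝ} (hβ : 0 < β) (a b : ℝ) :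
    IntervalIntegrable (kern β) volume a b :=
  (intervalIntegral.intervalIntegrable_rpow' (by linarith)).div_const _

theorem kern_sub_intervalIntegrable {β : ℝ} (hβ : 0 < β) (t a b : ℝ) :
    IntervalIntegrable (fun s => kern β (t - s)) volume a b := by
  simpa using (kern_intervalIntegrable hβ (t - a) (t - b)).comp_sub_left t

variable {E : Type*} [NormedAddCommGroup E]

section NormedSpace

variable [NormedSpace ℝ E]

theorem pwPoly_kern_intervalIntegrable {v : ℝ → E} (hv : v ∈ pwPoly E) {β : ℝ} (hβ : 0 < β)
    (t a b : ℝ) : IntervalIntegrable (fun s => kern β (t - s) • v s) volume a b :=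
  pwPoly_smul_intervalIntegrable hv (kern_sub_intervalIntegrable hβ t a b)

theorem fracInt_add {v w : ℝ → E} (hv : v ∈ pwPoly E) (hw : w ∈ pwPoly E) {β : ℝ} (hβ : 0 < β)
    (a : ℝ) : fracInt a β (v + w) = fracInt a β v + fracInt a β w := by
  ext t
  simp only [fracInt, Pi.add_apply, smul_add]
  exact intervalIntegral.integral_add (pwPoly_kern_intervalIntegrable hv hβ _ _ _)
    (pwPoly_kern_intervalIntegrable hw hβ _ _ _)

theorem fracInt_smul (c : ℝ) (v : ℝ → E) (β a : ℝ) :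
    fracInt a β (c • v) = c • fracInt a β v := by
  ext t
  simp only [fracInt, Pi.smul_apply, smul_comm _ c]
  exact intervalIntegral.integral_smul _ _

theorem fracInt_sub {v w : ℝ → E} (hv : v ∈ pwPoly E) (hw : w ∈ pwPoly E) {β : ℝ} (hβ : 0 < β)
    (a : ℝ) : fracInt a β (v - w) = fracInt a β v - fracInt a β w := by
  ext t
  simp only [fracInt, Pi.sub_apply, smul_sub]
  exact intervalIntegral.integral_sub (pwPoly_kern_intervalIntegrable hv hβ _ _ _)
    (pwPoly_kern_intervalIntegrable hw hβ _ _ _)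

theorem fracInt_self (a β : ℝ) (v : ℝ → E) : fracInt a β v a = 0 :=
  intervalIntegral.integral_same

/-- The substitution `s = a + (t - a) u` pulls out the power of `t - a`. The remaining Beta integral
is a constant whose value never matters. -/
theorem fracInt_truncatedPower {β a : ℝ} (ha : 0 ≤ a) (k : ℕ) (A : E) {t : ℝ}
    (ht : 0 ≤ t) :
    fracInt 0 β ((Ioi a).indicator fun s => (s - a) ^ k • A) t =
      (Ioi a).indicator (fun t => (t - a) ^ (k + β) •
        ∫ u in (0 : ℝ)..1, (kern β (1 - u) * u ^ k) • A) t := by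
  have hkey : fracInt 0 β ((Ioi a).indicator fun s => (s - a) ^ k • A) t =
      ∫ s in Ioc 0 t ∩ Ioi a, kern β (t - s) • (s - a) ^ k • A := by
    rw [fracInt, intervalIntegral.integral_of_le ht, ← setIntegral_indicator measurableSet_Ioi]
    congr 1
    ext s
    by_cases h : a < s <;> simp [h]
  rw [hkey]
  have hset : Ioc 0 t ∩ Ioi a = Ioc a t := by
    ext s
    simp only [mem_inter_iff, mem_Ioc, mem_Ioi]
    constructor
    · exact fun h => ⟨h.2, h.1.2⟩
    · exact fun h => ⟨⟨ha.trans_lt h.1, h.2⟩, h.1⟩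
  rw [hset]
  by_cases h : a < t
  · rw [indicator_of_mem (show t ∈ Ioi a from h), ← intervalIntegral.integral_of_le h.le]
    have h0 : 0 < t - a := sub_pos.2 h
    have := intervalIntegral.smul_integral_comp_mul_add (a := 0) (b := 1)
      (fun s => kern β (t - s) • (s - a) ^ k • A) (t - a) a
    rw [show (t - a) * 0 + a = a by ring, show (t - a) * 1 + a = t by ring] at this
    rw [← this, ← intervalIntegral.integral_smul, ← intervalIntegral.integral_smul]
    refine intervalIntegral.integral_congr fun u hu => ?_
    rw [uIcc_of_le zero_le_one] at hu
    simp only [smul_smul]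
    congr 1
    have e1 : t - ((t - a) * u + a) = (t - a) * (1 - u) := by ring
    have e2 : (t - a) * u + a - a = (t - a) * u := by ring
    have e3 : (t - a) ^ ((k : ℝ) + β) = (t - a) * ((t - a) ^ (β - 1) * (t - a) ^ k) := by
      rw [← Real.rpow_natCast (t - a) k, ← Real.rpow_add h0]
      nth_rewrite 2 [← Real.rpow_one (t - a)]
      rw [← Real.rpow_add h0]
      congr 1
      ring
    rw [e1, e2, e3, kern, kern, Real.mul_rpow h0.le (by linarith [hu.2]), mul_pow]
    ring
  · rw [indicator_of_notMem (by simpa using h), Ioc_eq_empty h]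
    simp

/-- Taylor expansion at the breakpoint `a`. Truncated powers are the generators whose fractional
integrals are explicit. -/
theorem pwPoly_eq_span_truncatedPower : pwPoly E = Submodule.span ℝ
    {w | ∃ (a : ℝ) (k : ℕ) (A : E), 0 ≤ a ∧ w = (Ioi a).indicator fun s => (s - a) ^ k • A} := by
  apply le_antisymm
  · refine Submodule.span_le.2 ?_
    rintro _ ⟨a, q, A, ha, rfl⟩
    have : ((Ioi a).indicator fun s => q.eval s • A) =
        ∑ i ∈ (q.taylor a).support, (q.taylor a).coeff i •
          (Ioi a).indicator fun s => (s - a) ^ i • A := by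
      ext s
      rw [Finset.sum_apply]
      by_cases h : s ∈ Ioi a
      · simp only [Pi.smul_apply, indicator_of_mem h, smul_smul, ← Finset.sum_smul]
        congr 1
        conv_lhs => rw [← Polynomial.sum_taylor_eq q a]
        simp [Polynomial.sum_def, Polynomial.eval_finsetSum]
      · simp only [Pi.smul_apply, indicator_of_notMem h, smul_zero, Finset.sum_const_zero]
    rw [this]
    exact Submodule.sum_mem _ fun i _ => Submodule.smul_mem _ _
      (Submodule.subset_span ⟨a, i, A, ha, rfl⟩)
  · refine Submodule.span_le.2 ?_
    rintro _ ⟨a, k, A, ha, rfl⟩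
    have := indicator_Ioi_mem_pwPoly ha ((Polynomial.X - Polynomial.C a) ^ k) A
    simp only [Polynomial.eval_pow, Polynomial.eval_sub, Polynomial.eval_X,
      Polynomial.eval_C] at this
    exact this

/-- The fractional integral of a piecewise polynomial is continuous, and it is differentiable with
an integrable derivative away from finitely many points. -/
theorem fracInt_regular {v : ℝ → E} (hv : v ∈ pwPoly E) {β : ℝ} (hβ : 0 < β) :
    ContinuousOn (fracInt 0 β v) (Ici 0) ∧ ∃ S : Set ℝ, S.Finite ∧ ∃ D : ℝ → E,
      (∀ t, 0 < t → t ∉ S → HasDerivAt (fracInt 0 β v) (D t) t) ∧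
      ∀ a b, IntervalIntegrable D volume a b := by
  have hv' := hv
  rw [pwPoly_eq_span_truncatedPower] at hv'
  induction hv' using Submodule.span_induction with
  | mem x hx =>
    obtain ⟨a, k, A, ha, rfl⟩ := hx
    set B : E := ∫ u in (0 : ℝ)..1, (kern β (1 - u) * u ^ k) • A with hB
    set w : ℝ → E := (Ioi a).indicator fun s => (s - a) ^ k • A with hw
    have hform : ∀ t, 0 ≤ t → fracInt 0 β w t =
        (Ioi a).indicator (fun t => (t - a) ^ (k + β) • B) t :=
      fun t ht => fracInt_truncatedPower ha k A ht
    have hkβ : 0 < (k : ℝ) + β := by positivity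
    refine ⟨?_, {a}, finite_singleton a, (Ioi a).indicator fun t =>
      ((k + β) * (t - a) ^ (k + β - 1)) • B, ?_, ?_⟩
    · have hc : Continuous fun t : ℝ => (max (t - a) 0) ^ ((k : ℝ) + β) • B :=
        (((continuous_id.sub continuous_const).max continuous_const).rpow_const
          fun _ => Or.inr hkβ.le).smul continuous_const
      refine hc.continuousOn.congr fun t ht => ?_
      rw [hform t ht]
      beta_reduce
      by_cases h : a < t
      · rw [indicator_of_mem (show t ∈ Ioi a from h), max_eq_left (sub_pos.2 h).le]
      · rw [indicator_of_notMem (show t ∉ Ioi a from h), max_eq_right (sub_nonpos.2 (not_lt.1 h)),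
          Real.zero_rpow hkβ.ne', zero_smul]
    · intro t ht hta
      rcases lt_or_gt_of_ne (show t ≠ a from hta) with h | h
      · rw [indicator_of_notMem (by simpa using h.le)]
        refine (hasDerivAt_const t (0 : E)).congr_of_eventuallyEq ?_
        filter_upwards [Iio_mem_nhds h, Ioi_mem_nhds ht] with s hs hs0
        rw [hform s (mem_Ioi.1 hs0).le]
        exact indicator_of_notMem (not_lt.2 (mem_Iio.1 hs).le) _
      · rw [indicator_of_mem (show t ∈ Ioi a from h)]
        have h1 := (((hasDerivAt_id t).sub_const a).rpow_const (p := k + β)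
          (Or.inl (sub_pos.2 h).ne')).smul_const B
        rw [one_mul] at h1
        refine h1.congr_of_eventuallyEq ?_
        filter_upwards [Ioi_mem_nhds h, Ioi_mem_nhds ht] with s hs hs0
        rw [hform s (mem_Ioi.1 hs0).le, indicator_of_mem hs]
        rfl
    · intro b c
      -- The exponent `k + β - 1` exceeds `-1`, so the derivative may blow up at `a` but stays
      -- integrable.
      have h1 : IntervalIntegrable (fun t : ℝ => t ^ ((k : ℝ) + β - 1)) volume (b - a) (c - a) :=
        intervalIntegral.intervalIntegrable_rpow' (by linarith)
      have h2 := h1.comp_sub_right a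
      simp only [sub_add_cancel] at h2
      have h3 := h2.const_mul (k + β)
      rw [intervalIntegrable_iff] at h3 ⊢
      exact (h3.smul_const B).indicator measurableSet_Ioi
  | zero =>
    have : fracInt 0 β (0 : ℝ → E) = 0 := by ext t; simp [fracInt]
    rw [this]
    exact ⟨continuousOn_const, ∅, finite_empty, 0, fun t _ _ => hasDerivAt_const _ _,
      fun a b => intervalIntegrable_const (c := (0 : E))⟩
  | add x y hx' hy' hx hy =>
    rw [← pwPoly_eq_span_truncatedPower] at hx' hy'
    obtain ⟨hxc, S, hS, D, hD, hDi⟩ := hx hx'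
    obtain ⟨hyc, S', hS', D', hD', hDi'⟩ := hy hy'
    rw [fracInt_add hx' hy' hβ]
    exact ⟨hxc.add hyc, S ∪ S', hS.union hS', D + D', fun t ht h =>
      (hD t ht fun h' => h (Or.inl h')).add (hD' t ht fun h' => h (Or.inr h')),
      fun a b => (hDi a b).add (hDi' a b)⟩
  | smul c x hx' hx =>
    rw [← pwPoly_eq_span_truncatedPower] at hx'
    obtain ⟨hxc, S, hS, D, hD, hDi⟩ := hx hx'
    rw [fracInt_smul]
    exact ⟨hxc.const_smul c, S, hS, c • D, fun t ht h => (hD t ht h).const_smul c,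
      fun a b => (hDi a b).smul c⟩

theorem fracInt_differentiableAt {v : ℝ → E} (hv : v ∈ pwPoly E) {β : ℝ} (hβ : 0 < β) :
    ∃ S : Set ℝ, S.Finite ∧ ∀ t, 0 < t → t ∉ S → DifferentiableAt ℝ (fracInt 0 β v) t := by
  obtain ⟨-, S, hS, D, hD, -⟩ := fracInt_regular hv hβ
  exact ⟨S, hS, fun t ht h => (hD t ht h).differentiableAt⟩

theorem rlDeriv_intervalIntegrable {v : ℝ → E} (hv : v ∈ pwPoly E) {α : ℝ}
    (hα1 : α < 1) {a b : ℝ} (ha : 0 ≤ a) (hab : a ≤ b) :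
    IntervalIntegrable (rlDeriv 0 α v) volume a b := by
  obtain ⟨-, S, hS, D, hD, hDi⟩ := fracInt_regular hv (sub_pos.2 hα1)
  refine (hDi a b).congr_ae ?_
  rw [uIoc_of_le hab]
  refine (ae_restrict_iff' measurableSet_Ioc).2 ?_
  filter_upwards [hS.countable.ae_notMem volume] with t ht h
  exact (hD t (ha.trans_lt h.1) ht).deriv.symm

theorem integral_rlDeriv [CompleteSpace E] {v : ℝ → E} (hv : v ∈ pwPoly E) {α : ℝ}
    (hα1 : α < 1) {a b : ℝ} (ha : 0 ≤ a) (hab : a ≤ b) :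
    ∫ t in a..b, rlDeriv 0 α v t = fracInt 0 (1 - α) v b - fracInt 0 (1 - α) v a := by
  obtain ⟨hc, S, hS, D, hD, hDi⟩ := fracInt_regular hv (sub_pos.2 hα1)
  refine integral_eq_of_hasDerivAt_off_countable_of_le _ _ hab hS.countable
    (hc.mono fun t ht => ha.trans ht.1) (fun t ht => ?_)
    (rlDeriv_intervalIntegrable hv hα1 ha hab)
  exact (hD t (ha.trans_lt ht.1.1) ht.2).differentiableAt.hasDerivAt

end NormedSpace

end

section

/-! ### Coercivity of the Riemann--Liouville derivative -/

theorem integral_kern_sub {β : ℝ} (hβ : 0 < β) (a t : ℝ) :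
    ∫ s in a..t, kern β (t - s) = (t - a) ^ β / (β * Real.Gamma β) := by
  rw [intervalIntegral.integral_comp_sub_left (fun s => kern β s), sub_self]
  simp only [kern]
  rw [intervalIntegral.integral_div, integral_rpow (Or.inl (by linarith)), sub_add_cancel,
    Real.zero_rpow hβ.ne', sub_zero, div_div]

variable {E : Type*} [NormedAddCommGroup E]

/-- At a point where a nonnegative function vanishes, its Riemann--Liouville derivative is not
positive. -/
theorem fracInt_hasDerivAt_nonpos {g : ℝ → ℝ} (hg : g ∈ pwPoly ℝ) (hg0 : ∀ s, 0 ≤ g s) {β : ℝ}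
    (hβ : 0 < β) (hβ1 : β ≤ 1) {t C η : ℝ} (ht : 0 < t) (hC : 0 ≤ C) (hη : 0 < η)
    (hgC : ∀ s ∈ Ioc (t - η) t, g s ≤ C * (t - s)) {d : ℝ}
    (hd : HasDerivAt (fracInt 0 β g) d t) : d ≤ 0 := by
  have hlim := hd.tendsto_slope_zero_left
  have hlim' : Tendsto (fun h : ℝ => C * (-h) ^ β / (β * Real.Gamma β)) (𝓝[<] 0) (𝓝 0) := by
    have hc : Continuous fun h : ℝ => C * (-h) ^ β / (β * Real.Gamma β) :=
      (continuous_const.mul (continuous_neg.rpow_const fun _ => Or.inr hβ.le)).div_const _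
    have := (hc.tendsto 0).mono_left (nhdsWithin_le_nhds (s := Iio 0))
    simpa [Real.zero_rpow hβ.ne'] using this
  refine le_of_tendsto_of_tendsto hlim hlim' ?_
  have hmem : Ioo (-(min η t)) 0 ∈ 𝓝[<] (0 : ℝ) :=
    Ioo_mem_nhdsLT (by simp [hη, ht])
  filter_upwards [hmem] with h hh
  obtain ⟨h1, h2⟩ := hh
  have hhη : -h < η := by linarith [min_le_left η t]
  have hht : -h < t := by linarith [min_le_right η t]
  have hI : ∀ t a b, IntervalIntegrable (fun s => kern β (t - s) * g s) volume a b :=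
    fun t a b => pwPoly_kern_intervalIntegrable hg hβ t a b
  have hsplit : fracInt 0 β g t = (∫ s in (0 : ℝ)..(t + h), kern β (t - s) * g s) +
      ∫ s in (t + h)..t, kern β (t - s) * g s :=
    (intervalIntegral.integral_add_adjacent_intervals (hI _ _ _) (hI _ _ _)).symm
  -- The kernel decreases, so moving the evaluation point from `t + h` to the later `t` only lowers
  -- the contribution of the common past. The comparison is on an open interval because `kern β 0`
  -- is `0` for `β < 1`, which breaks monotonicity at the endpoint.
  have hfirst : ∫ s in (0 : ℝ)..(t + h), kern β (t - s) * g s ≤ fracInt 0 β g (t + h) := by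
    refine intervalIntegral.integral_mono_on_of_le_Ioo (by linarith) (hI _ _ _) (hI _ _ _) ?_
    intro s hs
    exact mul_le_mul_of_nonneg_right
      (kern_antitone hβ hβ1 (by linarith [hs.2]) (by linarith)) (hg0 s)
  -- The most recent piece is of order `(-h)^(1 + β)` because `g` is at most linear near `t`. Its
  -- quotient by `-h` tends to `0`.
  have hsecond : ∫ s in (t + h)..t, kern β (t - s) * g s ≤
      C * (-h) * ((-h) ^ β / (β * Real.Gamma β)) := by
    have e := integral_kern_sub hβ (t + h) t
    rw [show t - (t + h) = -h by ring] at e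
    rw [← e, ← intervalIntegral.integral_const_mul]
    refine intervalIntegral.integral_mono_on_of_le_Ioo (by linarith) (hI _ _ _)
      ((kern_sub_intervalIntegrable hβ _ _ _).const_mul _) ?_
    intro s hs
    rw [mul_comm]
    refine mul_le_mul_of_nonneg_right ?_ (kern_nonneg hβ (by linarith [hs.2]))
    exact (hgC s ⟨by linarith [hs.1], hs.2.le⟩).trans
      (mul_le_mul_of_nonneg_left (by linarith [hs.1]) hC)
  have hh : 0 < -h := by linarith
  rw [smul_eq_mul, show h⁻¹ * (fracInt 0 β g (t + h) - fracInt 0 β g t) =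
    (-h)⁻¹ * (fracInt 0 β g t - fracInt 0 β g (t + h)) by rw [inv_neg]; ring]
  rw [← div_eq_inv_mul, div_le_iff₀ hh]
  calc fracInt 0 β g t - fracInt 0 β g (t + h) ≤ C * (-h) * ((-h) ^ β / (β * Real.Gamma β)) := by
        linarith
    _ = _ := by ring

theorem fracInt_const {β : ℝ} (hβ : 0 < β) {A : ℝ} {t : ℝ} (ht : 0 ≤ t) :
    fracInt 0 β ((Ioi (0 : ℝ)).indicator fun _ => A) t = t ^ β / (β * Real.Gamma β) * A := by
  rw [← sub_zero t, ← integral_kern_sub hβ 0 t, ← intervalIntegral.integral_mul_const, sub_zero]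
  refine intervalIntegral.integral_congr_Ioo_of_le ht fun s hs => ?_
  simp [mem_Ioi.2 hs.1]

theorem hasDerivAt_fracInt_const {β : ℝ} (hβ : 0 < β) {A : ℝ} {t : ℝ} (ht : 0 < t) :
    HasDerivAt (fracInt 0 β ((Ioi (0 : ℝ)).indicator fun _ => A)) (kern β t * A) t := by
  have h := ((Real.hasDerivAt_rpow_const (p := β) (Or.inl ht.ne')).div_const
    (β * Real.Gamma β)).mul_const A
  have e : β * t ^ (β - 1) / (β * Real.Gamma β) * A = kern β t * A := by
    rw [kern, mul_div_mul_left _ _ hβ.ne']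
  rw [e] at h
  refine h.congr_of_eventuallyEq ?_
  filter_upwards [Ioi_mem_nhds ht] with s hs
  exact fracInt_const hβ (mem_Ioi.1 hs).le

variable [InnerProductSpace ℝ E]

theorem fracInt_inner_const [CompleteSpace E] {v : ℝ → E} (hv : v ∈ pwPoly E) {β : ℝ} (hβ : 0 < β)
    (x : E) (a : ℝ) :
    fracInt a β (fun s => inner ℝ x (v s)) = fun t => inner ℝ x (fracInt a β v t) := by
  ext t
  have := (innerSL ℝ x).intervalIntegral_comp_comm
    (pwPoly_kern_intervalIntegrable hv hβ t a t)
  simpa [fracInt, inner_smul_right] using this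

/-- The pointwise coercivity of the Riemann--Liouville derivative. -/
theorem rlDeriv_norm_sq_le [CompleteSpace E] {v : ℝ → E} (hv : v ∈ pwPoly E) {α : ℝ} (hα0 : 0 < α)
    (hα1 : α < 1) :
    ∃ S : Set ℝ, S.Finite ∧ ∀ t, 0 < t → t ∉ S →
      rlDeriv 0 α (fun s => ‖v s‖ ^ 2) t + kern (1 - α) t * ‖v t‖ ^ 2 ≤
        2 * inner ℝ (rlDeriv 0 α v t) (v t) := by
  have hβ : 0 < 1 - α := sub_pos.2 hα1
  have hv2 := pwPoly_norm_sq hv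
  obtain ⟨S₁, hS₁, h₁⟩ := fracInt_differentiableAt hv hβ
  obtain ⟨S₂, hS₂, h₂⟩ := fracInt_differentiableAt hv2 hβ
  obtain ⟨S₃, hS₃, h₃⟩ := pwPoly_differentiableAt hv
  refine ⟨S₁ ∪ S₂ ∪ S₃, (hS₁.union hS₂).union hS₃, fun t ht hS => ?_⟩
  simp only [mem_union, not_or] at hS
  set x := v t with hx
  set c : ℝ → E := (Ioi (0 : ℝ)).indicator fun _ => x with hc
  set q : ℝ → ℝ := (Ioi (0 : ℝ)).indicator fun _ => ‖x‖ ^ 2 with hq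
  have hcm : c ∈ pwPoly E := indicator_const_mem_pwPoly x
  have hqm : q ∈ pwPoly ℝ := indicator_const_mem_pwPoly _
  have hix : (fun s => inner ℝ x (v s)) ∈ pwPoly ℝ := pwPoly_map hv (innerSL ℝ x).toLinearMap
  -- The value `v t` is frozen as `x`. The nonnegative function `g` vanishes at `t`, so its
  -- fractional derivative there is not positive, and expanding the square gives the claim.
  set g : ℝ → ℝ := fun s => ‖v s - c s‖ ^ 2 with hg
  have hgm : g ∈ pwPoly ℝ := pwPoly_norm_sq ((pwPoly E).sub_mem hv hcm)
  -- The frozen constants are cut off on the negative half line, so `g'` need only agree with `g`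
  -- for positive arguments, which is all the fractional integral sees.
  set g' : ℝ → ℝ := ((fun s => ‖v s‖ ^ 2) + q) - (2 : ℝ) • fun s => inner ℝ x (v s) with hg'
  have heq : ∀ s, 0 < s → g s = g' s := by
    intro s hs
    simp only [hg, hg', hc, hq, Pi.sub_apply, Pi.add_apply, Pi.smul_apply,
      indicator_of_mem (mem_Ioi.2 hs), norm_sub_sq_real, smul_eq_mul, real_inner_comm x]
    ring
  have hder : HasDerivAt (fracInt 0 (1 - α) g') (rlDeriv 0 α (fun s => ‖v s‖ ^ 2) t +
      kern (1 - α) t * ‖x‖ ^ 2 - (2 : ℝ) • inner ℝ x (rlDeriv 0 α v t)) t := by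
    rw [hg', fracInt_sub ((pwPoly ℝ).add_mem hv2 hqm) ((pwPoly ℝ).smul_mem _ hix) hβ,
      fracInt_add hv2 hqm hβ, fracInt_smul, fracInt_inner_const hv hβ]
    refine ((h₂ t ht hS.1.2).hasDerivAt.add (hasDerivAt_fracInt_const hβ ht)).sub ?_
    refine HasDerivAt.const_smul (2 : ℝ) ?_
    exact (innerSL ℝ x).hasFDerivAt.comp_hasDerivAt t (h₁ t ht hS.1.1).hasDerivAt
  have hder' : HasDerivAt (fracInt 0 (1 - α) g) (rlDeriv 0 α (fun s => ‖v s‖ ^ 2) t +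
      kern (1 - α) t * ‖x‖ ^ 2 - (2 : ℝ) • inner ℝ x (rlDeriv 0 α v t)) t := by
    refine hder.congr_of_eventuallyEq ?_
    filter_upwards [Ioi_mem_nhds ht] with τ hτ
    refine intervalIntegral.integral_congr_Ioo_of_le (mem_Ioi.1 hτ).le fun s hs => ?_
    simp only [heq s hs.1]
  -- Differentiability of `v` at `t` makes `g s` of order `(t - s)²`, hence at most linear in `t -
  -- s` on a short interval.
  obtain ⟨K, hK⟩ := (h₃ t hS.2).isBigO_sub.bound
  obtain ⟨η, hη, hball⟩ := Metric.eventually_nhds_iff.1 hK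
  have key := fracInt_hasDerivAt_nonpos hgm (fun s => by positivity) hβ (by linarith) ht
    (C := K ^ 2 * min (η / 2) (t / 2)) (η := min (η / 2) (t / 2)) (by positivity) (by positivity)
    (fun s hs => ?_) hder'
  · rw [real_inner_comm, smul_eq_mul] at key
    linarith
  · have hm1 := min_le_left (η / 2) (t / 2)
    have hm2 := min_le_right (η / 2) (t / 2)
    have hs0 : 0 < s := by linarith [hs.1]
    have hd : dist s t < η := by
      rw [Real.dist_eq, abs_lt]; constructor <;> linarith [hs.1, hs.2]
    have hb := hball hd
    rw [Real.norm_eq_abs, abs_of_nonpos (by linarith [hs.2] : s - t ≤ 0), neg_sub] at hb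
    simp only [hg, hc, indicator_of_mem (mem_Ioi.2 hs0)]
    calc ‖v s - x‖ ^ 2 ≤ (K * (t - s)) ^ 2 := by gcongr
      _ = K ^ 2 * (t - s) * (t - s) := by ring
      _ ≤ K ^ 2 * min (η / 2) (t / 2) * (t - s) := by
        gcongr
        · linarith [hs.2]
        · linarith [hs.1]

theorem rlDeriv_inner_intervalIntegrable [CompleteSpace E] {v w : ℝ → E} (hv : v ∈ pwPoly E)
    (hw : w ∈ pwPoly E) {α : ℝ} (hα1 : α < 1) {a b : ℝ} (ha : 0 ≤ a) (hab : a ≤ b) :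
    IntervalIntegrable (fun t => inner ℝ (rlDeriv 0 α v t) (w t)) volume a b :=
  pwPoly_inner_intervalIntegrable (rlDeriv_intervalIntegrable hv hα1 ha hab) hw

theorem pwPoly_norm_sq_intervalIntegrable {v : ℝ → E} (hv : v ∈ pwPoly E) (a b : ℝ) :
    IntervalIntegrable (fun s => ‖v s‖ ^ 2) volume a b :=
  pwPoly_intervalIntegrable (pwPoly_norm_sq hv) a b

theorem pwPoly_kern_norm_sq_intervalIntegrable {v : ℝ → E} (hv : v ∈ pwPoly E) {β : ℝ}
    (hβ : 0 < β) (a b : ℝ) :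
    IntervalIntegrable (fun s => kern β s * ‖v s‖ ^ 2) volume a b :=
  pwPoly_smul_intervalIntegrable (pwPoly_norm_sq hv) (kern_intervalIntegrable hβ a b)

/-- The energy inequality for the Riemann--Liouville derivative. -/
theorem energy_le_integral_rlDeriv [CompleteSpace E] {v : ℝ → E} (hv : v ∈ pwPoly E) {α : ℝ}
    (hα0 : 0 < α) (hα1 : α < 1) {a b : ℝ} (ha : 0 ≤ a) (hab : a ≤ b) :
    fracInt 0 (1 - α) (fun s => ‖v s‖ ^ 2) b - fracInt 0 (1 - α) (fun s => ‖v s‖ ^ 2) a +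
      ∫ t in a..b, kern (1 - α) t * ‖v t‖ ^ 2 ≤
        2 * ∫ t in a..b, inner ℝ (rlDeriv 0 α v t) (v t) := by
  have hβ : 0 < 1 - α := sub_pos.2 hα1
  have hv2 := pwPoly_norm_sq hv
  obtain ⟨S, hS, h⟩ := rlDeriv_norm_sq_le hv hα0 hα1
  have hi1 := rlDeriv_intervalIntegrable hv2 hα1 ha hab
  have hi2 := pwPoly_kern_norm_sq_intervalIntegrable hv hβ a b
  rw [← integral_rlDeriv hv2 hα1 ha hab, ← intervalIntegral.integral_add hi1 hi2,
    ← intervalIntegral.integral_const_mul]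
  refine intervalIntegral.integral_mono_ae_restrict hab (hi1.add hi2)
    ((rlDeriv_inner_intervalIntegrable hv hv hα1 ha hab).const_mul 2) ?_
  have hne : ∀ᵐ t : ℝ, t ∉ S ∪ {a} :=
    (hS.union (finite_singleton a)).countable.ae_notMem volume
  refine (ae_restrict_iff' measurableSet_Icc).2 ?_
  filter_upwards [hne] with t ht hmem
  simp only [mem_union, mem_singleton_iff, not_or] at ht
  exact h t (lt_of_le_of_lt ha (lt_of_le_of_ne hmem.1 (Ne.symm ht.2))) ht.1

/-- All lags are at most `b`, where the decreasing kernel is smallest. With `kern_mul_integral_le`,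
both terms on the left of the energy inequality control the same multiple of the `L²` norm. -/
theorem kern_mul_integral_le_fracInt {v : ℝ → E} (hv : v ∈ pwPoly E) {β : ℝ} (hβ : 0 < β)
    (hβ1 : β ≤ 1) {b : ℝ} (hb : 0 ≤ b) :
    kern β b * ∫ t in (0 : ℝ)..b, ‖v t‖ ^ 2 ≤ fracInt 0 β (fun s => ‖v s‖ ^ 2) b := by
  rw [← intervalIntegral.integral_const_mul]
  refine intervalIntegral.integral_mono_on_of_le_Ioo hb
    ((pwPoly_norm_sq_intervalIntegrable hv _ _).const_mul _)
    (pwPoly_kern_intervalIntegrable (pwPoly_norm_sq hv) hβ _ _ _) fun s hs => ?_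
  exact mul_le_mul_of_nonneg_right
    (kern_antitone hβ hβ1 (by linarith [hs.2]) (by linarith [hs.1])) (by positivity)

theorem kern_mul_integral_le {v : ℝ → E} (hv : v ∈ pwPoly E) {β : ℝ} (hβ : 0 < β)
    (hβ1 : β ≤ 1) {b : ℝ} (hb : 0 ≤ b) :
    kern β b * ∫ t in (0 : ℝ)..b, ‖v t‖ ^ 2 ≤ ∫ t in (0 : ℝ)..b, kern β t * ‖v t‖ ^ 2 := by
  rw [← intervalIntegral.integral_const_mul]
  refine intervalIntegral.integral_mono_on_of_le_Ioo hb
    ((pwPoly_norm_sq_intervalIntegrable hv _ _).const_mul _)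
    (pwPoly_kern_norm_sq_intervalIntegrable hv hβ _ _) fun s hs => ?_
  exact mul_le_mul_of_nonneg_right (kern_antitone hβ hβ1 hs.1 hs.2.le) (by positivity)

end

section

/-! ### Convolutions over the remote history -/

theorem hasDerivAt_kern (β : ℝ) {t : ℝ} (ht : 0 < t) :
    HasDerivAt (kern β) (kern (β - 1) t) t := by
  have h := (Real.hasDerivAt_rpow_const (p := β - 1) (Or.inl ht.ne')).div_const (Real.Gamma β)
  suffices e : kern (β - 1) t = (β - 1) * t ^ (β - 1 - 1) / Real.Gamma β by rw [e]; exact h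
  simp only [kern]
  rcases eq_or_ne (β - 1) 0 with h0 | h0
  -- For `β = 1` the convention `Γ(0) = 0` makes `kern 0` vanish, in agreement with `kern 1` being
  -- constant.
  · simp [h0]
  · have hG := Real.Gamma_add_one h0
    rw [sub_add_cancel] at hG
    rw [hG, mul_div_mul_left _ _ h0]

theorem kern_continuousOn (β : ℝ) : ContinuousOn (kern β) (Ioi 0) := fun _ ht =>
  (hasDerivAt_kern β (mem_Ioi.1 ht)).continuousAt.continuousWithinAt

/-- The sign is that of `Γ(-α)`, read off from `Γ(1 - α) = -α Γ(-α)`. -/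
theorem kern_neg_nonpos {α : ℝ} (hα0 : 0 < α) (hα1 : α < 1) {t : ℝ} (ht : 0 ≤ t) :
    kern (-α) t ≤ 0 := by
  refine div_nonpos_of_nonneg_of_nonpos (Real.rpow_nonneg ht _) ?_
  have h := Real.Gamma_add_one (neg_ne_zero.2 hα0.ne')
  have h' := Real.Gamma_pos_of_pos (show 0 < -α + 1 by linarith)
  rw [h] at h'
  exact (neg_of_mul_pos_right h' (by linarith)).le

variable {E : Type*} [NormedAddCommGroup E]

section NormedSpace

variable [NormedSpace ℝ E]

theorem comp_sub_intervalIntegrable {ρ : ℝ → ℝ} (hρ : ContinuousOn ρ (Ioi 0)) {b t : ℝ}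
    (hb : 0 ≤ b) (hbt : b < t) : IntervalIntegrable (fun s => ρ (t - s)) volume 0 b := by
  refine ContinuousOn.intervalIntegrable (hρ.comp (by fun_prop) fun s hs => ?_)
  rw [uIcc_of_le hb] at hs
  exact sub_pos.2 (hs.2.trans_lt hbt)

theorem pwPoly_comp_sub_intervalIntegrable {v : ℝ → E} (hv : v ∈ pwPoly E) {ρ : ℝ → ℝ}
    (hρ : ContinuousOn ρ (Ioi 0)) {b t : ℝ} (hb : 0 ≤ b) (hbt : b < t) :
    IntervalIntegrable (fun s => ρ (t - s) • v s) volume 0 b :=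
  pwPoly_smul_intervalIntegrable hv (comp_sub_intervalIntegrable hρ hb hbt)

/-- The history ends at `b < t`, so for `τ` near `t` the lags `τ - s` lie in a compact subset of
`(0, ∞)`. This supplies the dominating function for passing limits and derivatives under the
integral. -/
theorem exists_bound_comp_sub {ρ : ℝ → ℝ} (hρ : ContinuousOn ρ (Ioi 0)) {b t : ℝ}
    (hbt : b < t) : ∃ M, ∀ τ ∈ Metric.ball t ((t - b) / 2), ∀ s ∈ Ioc 0 b, ‖ρ (τ - s)‖ ≤ M := by
  obtain ⟨M, hM⟩ := (isCompact_Icc (a := (t - b) / 2) (b := t + (t - b) / 2)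
    ).exists_bound_of_continuousOn (hρ.mono fun x hx =>
      mem_Ioi.2 (lt_of_lt_of_le (by linarith) hx.1))
  refine ⟨M, fun τ hτ s hs => hM _ ?_⟩
  rw [Metric.mem_ball, Real.dist_eq, abs_lt] at hτ
  constructor <;> linarith [hs.1, hs.2, hτ.1, hτ.2]

theorem pwPoly_comp_sub_aestronglyMeasurable {v : ℝ → E} (hv : v ∈ pwPoly E) {ρ : ℝ → ℝ}
    (hρ : ContinuousOn ρ (Ioi 0)) {b t : ℝ} (hb : 0 ≤ b) (hbt : b < t) :
    ∀ᶠ τ in 𝓝 t, AEStronglyMeasurable (fun s => ρ (τ - s) • v s) (volume.restrict (uIoc 0 b)) := by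
  filter_upwards [Ioi_mem_nhds hbt] with τ hτ
  exact (intervalIntegrable_iff.1
    (pwPoly_comp_sub_intervalIntegrable hv hρ hb (mem_Ioi.1 hτ))).aestronglyMeasurable

theorem continuousAt_integral_comp_sub {v : ℝ → E} (hv : v ∈ pwPoly E) {ρ : ℝ → ℝ}
    (hρ : ContinuousOn ρ (Ioi 0)) {b t : ℝ} (hb : 0 ≤ b) (hbt : b < t) :
    ContinuousAt (fun τ => ∫ s in (0 : ℝ)..b, ρ (τ - s) • v s) t := by
  obtain ⟨M, hM⟩ := exists_bound_comp_sub hρ hbt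
  refine intervalIntegral.continuousAt_of_dominated_interval (bound := fun s => M * ‖v s‖)
    (pwPoly_comp_sub_aestronglyMeasurable hv hρ hb hbt) ?_
    ((pwPoly_intervalIntegrable hv 0 b).norm.const_mul M) ?_
  · filter_upwards [Metric.ball_mem_nhds t (show 0 < (t - b) / 2 by linarith)] with τ hτ
    refine Eventually.of_forall fun s hs => ?_
    rw [uIoc_of_le hb] at hs
    rw [norm_smul]
    exact mul_le_mul_of_nonneg_right (hM τ hτ s hs) (norm_nonneg _)
  · refine Eventually.of_forall fun s hs => ?_
    rw [uIoc_of_le hb] at hs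
    have : ContinuousAt ρ (t - s) := hρ.continuousAt (Ioi_mem_nhds (by linarith [hs.2]))
    exact (this.comp (f := fun τ => τ - s) (by fun_prop)).smul continuousAt_const

theorem integral_comp_sub_continuousOn {v : ℝ → E} (hv : v ∈ pwPoly E) {ρ : ℝ → ℝ}
    (hρ : ContinuousOn ρ (Ioi 0)) {b : ℝ} (hb : 0 ≤ b) :
    ContinuousOn (fun τ => ∫ s in (0 : ℝ)..b, ρ (τ - s) • v s) (Ioi b) := fun _ ht =>
  (continuousAt_integral_comp_sub hv hρ hb (mem_Ioi.1 ht)).continuousWithinAt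

theorem integral_comp_sub_intervalIntegrable {v : ℝ → E} (hv : v ∈ pwPoly E) {ρ : ℝ → ℝ}
    (hρ : ContinuousOn ρ (Ioi 0)) {b c d : ℝ} (hb : 0 ≤ b) (hbc : b < c) (hcd : c ≤ d) :
    IntervalIntegrable (fun τ => ∫ s in (0 : ℝ)..b, ρ (τ - s) • v s) volume c d := by
  refine ((integral_comp_sub_continuousOn hv hρ hb).mono fun t ht => ?_).intervalIntegrable
  rw [uIcc_of_le hcd] at ht
  exact hbc.trans_le ht.1

theorem hasDerivAt_integral_kern {v : ℝ → E} (hv : v ∈ pwPoly E) (β : ℝ) {b t : ℝ} (hb : 0 ≤ b)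
    (hbt : b < t) :
    HasDerivAt (fun τ => ∫ s in (0 : ℝ)..b, kern β (τ - s) • v s)
      (∫ s in (0 : ℝ)..b, kern (β - 1) (t - s) • v s) t := by
  have hρ := kern_continuousOn (β - 1)
  obtain ⟨M, hM⟩ := exists_bound_comp_sub hρ hbt
  refine (intervalIntegral.hasDerivAt_integral_of_dominated_loc_of_deriv_le
    (F := fun τ s => kern β (τ - s) • v s) (F' := fun τ s => kern (β - 1) (τ - s) • v s)
    (bound := fun s => M * ‖v s‖)
    (Metric.ball_mem_nhds t (show 0 < (t - b) / 2 by linarith))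
    (pwPoly_comp_sub_aestronglyMeasurable hv (kern_continuousOn β) hb hbt)
    (pwPoly_comp_sub_intervalIntegrable hv (kern_continuousOn β) hb hbt)
    (pwPoly_comp_sub_aestronglyMeasurable hv hρ hb hbt).self_of_nhds
    (Eventually.of_forall fun s hs τ hτ => ?_)
    ((pwPoly_intervalIntegrable hv 0 b).norm.const_mul M)
    (Eventually.of_forall fun s hs τ hτ => ?_)).2
  · rw [uIoc_of_le hb] at hs
    rw [norm_smul]
    exact mul_le_mul_of_nonneg_right (hM τ hτ s hs) (norm_nonneg _)
  · rw [uIoc_of_le hb] at hs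
    rw [Metric.mem_ball, Real.dist_eq, abs_lt] at hτ
    exact ((hasDerivAt_kern β (by linarith [hs.2, hτ.1])).comp_sub_const τ s).smul_const (v s)

/-- The inner integral is the time derivative of the `kern (1 - α)` convolution, so the fundamental
theorem of calculus applies. The resulting difference is what telescopes over time intervals. -/
theorem integral_integral_kern [CompleteSpace E] {v : ℝ → E} (hv : v ∈ pwPoly E) (α : ℝ) {b c d : ℝ}
    (hb : 0 ≤ b) (hbc : b < c) (hcd : c ≤ d) :
    ∫ t in c..d, ∫ s in (0 : ℝ)..b, kern (-α) (t - s) • v s =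
      (∫ s in (0 : ℝ)..b, kern (1 - α) (d - s) • v s) -
        ∫ s in (0 : ℝ)..b, kern (1 - α) (c - s) • v s := by
  refine intervalIntegral.integral_eq_sub_of_hasDerivAt
    (f := fun t => ∫ s in (0 : ℝ)..b, kern (1 - α) (t - s) • v s) (fun t ht => ?_)
    (integral_comp_sub_intervalIntegrable hv (kern_continuousOn _) hb hbc hcd)
  rw [uIcc_of_le hcd] at ht
  have := hasDerivAt_integral_kern hv (1 - α) hb (hbc.trans_le ht.1)
  rwa [show 1 - α - 1 = -α by ring] at this

/-- Splitting of the Riemann--Liouville derivative into a local part and the remote history. -/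
theorem rlDeriv_eq_local_add_history {v : ℝ → E} (hv : v ∈ pwPoly E) {α : ℝ} (hα1 : α < 1) :
    ∃ S : Set ℝ, S.Finite ∧ ∀ b t, 0 ≤ b → b < t → t ∉ S →
      rlDeriv 0 α v t = rlDeriv b α v t + ∫ s in (0 : ℝ)..b, kern (-α) (t - s) • v s := by
  have hβ : 0 < 1 - α := sub_pos.2 hα1
  obtain ⟨S, hS, h⟩ := fracInt_differentiableAt hv hβ
  refine ⟨S, hS, fun b t hb hbt ht => ?_⟩
  have h1 := (h t (hb.trans_lt hbt) ht).hasDerivAt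
  have h2 := hasDerivAt_integral_kern hv (1 - α) hb hbt
  rw [show 1 - α - 1 = -α by ring] at h2
  -- The local fractional integral is the full one minus the part over `(0, b)`, and that part is
  -- smooth beyond `b`. Hence the exceptional set does not depend on `b`.
  have e : fracInt b (1 - α) v =
      fracInt 0 (1 - α) v - fun τ => ∫ s in (0 : ℝ)..b, kern (1 - α) (τ - s) • v s := by
    ext τ
    rw [Pi.sub_apply, eq_sub_iff_add_eq, add_comm]
    exact intervalIntegral.integral_add_adjacent_intervals
      (pwPoly_kern_intervalIntegrable hv hβ _ _ _) (pwPoly_kern_intervalIntegrable hv hβ _ _ _)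
  have h3 := (h1.sub h2).deriv
  rw [← e] at h3
  unfold rlDeriv
  rw [h3, sub_add_cancel]

end NormedSpace

theorem integral_kern_neg {α b t : ℝ} (hb : 0 ≤ b) (hbt : b < t) :
    ∫ s in (0 : ℝ)..b, kern (-α) (t - s) = kern (1 - α) t - kern (1 - α) (t - b) := by
  rw [intervalIntegral.integral_comp_sub_left (fun s => kern (-α) s), sub_zero]
  have hmem : ∀ x ∈ uIcc (t - b) t, 0 < x := fun x hx => by
    rw [uIcc_of_le (by linarith)] at hx
    linarith [hx.1]
  refine intervalIntegral.integral_eq_sub_of_hasDerivAt (fun x hx => ?_)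
    ((kern_continuousOn (-α)).mono fun x hx => hmem x hx).intervalIntegrable
  have := hasDerivAt_kern (1 - α) (hmem x hx)
  rwa [show 1 - α - 1 = -α by ring] at this

variable [InnerProductSpace ℝ E]

/-- Young's inequality with weight `η` inside the integral. In the `‖x‖²` term the kernel is
integrated exactly by `integral_kern_neg`, and the favourable `-kern (1 - α) t` is dropped. -/
theorem inner_integral_comp_sub_le [CompleteSpace E] {z : ℝ → E} (hz : z ∈ pwPoly E) (x : E)
    {α : ℝ} (hα0 : 0 < α) (hα1 : α < 1) {ρ : ℝ → ℝ} (hρ : ContinuousOn ρ (Ioi 0)) {σ η b t : ℝ}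
    (hσ : 0 ≤ σ) (hη : 0 < η) (hb : 0 ≤ b) (hbt : b < t)
    (hbound : ∀ s ∈ Icc 0 b, |ρ (t - s)| ≤ σ * |kern (-α) (t - s)|) :
    inner ℝ (∫ s in (0 : ℝ)..b, ρ (t - s) • z s) x ≤
      σ / 2 * (η * -(∫ s in (0 : ℝ)..b, kern (-α) (t - s) • ‖z s‖ ^ 2) +
        η⁻¹ * (kern (1 - α) (t - b) * ‖x‖ ^ 2)) := by
  have hz2 := pwPoly_norm_sq hz
  have hk := kern_continuousOn (-α)
  have e1 : inner ℝ (∫ s in (0 : ℝ)..b, ρ (t - s) • z s) x =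
      ∫ s in (0 : ℝ)..b, ρ (t - s) * inner ℝ x (z s) := by
    rw [real_inner_comm]
    have := (innerSL ℝ x).intervalIntegral_comp_comm
      (pwPoly_comp_sub_intervalIntegrable hz hρ hb hbt)
    simpa [inner_smul_right] using this.symm
  have hix : (fun s => inner ℝ x (z s)) ∈ pwPoly ℝ := pwPoly_map hz (innerSL ℝ x).toLinearMap
  have i1 : IntervalIntegrable (fun s => ρ (t - s) * inner ℝ x (z s)) volume 0 b :=
    pwPoly_comp_sub_intervalIntegrable hix hρ hb hbt
  have i2 := pwPoly_comp_sub_intervalIntegrable hz2 hk hb hbt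
  have i3 := comp_sub_intervalIntegrable hk hb hbt
  have e2 : ∫ s in (0 : ℝ)..b, ρ (t - s) * inner ℝ x (z s) ≤
      ∫ s in (0 : ℝ)..b, (-(σ / 2 * η) * (kern (-α) (t - s) • ‖z s‖ ^ 2) +
        -(σ / 2 * η⁻¹ * ‖x‖ ^ 2) * kern (-α) (t - s)) := by
    refine intervalIntegral.integral_mono_on hb i1 ((i2.const_mul _).add (i3.const_mul _)) ?_
    intro s hs
    have hkn := kern_neg_nonpos hα0 hα1 (t := t - s) (by linarith [hs.2])
    have hb' := hbound s hs
    rw [abs_of_nonpos hkn] at hb'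
    have hyoung : ‖x‖ * ‖z s‖ ≤ η / 2 * ‖z s‖ ^ 2 + η⁻¹ / 2 * ‖x‖ ^ 2 := by
      have h := sq_nonneg (η * ‖z s‖ - ‖x‖)
      have h' : 0 ≤ η⁻¹ / 2 * (η * ‖z s‖ - ‖x‖) ^ 2 := by positivity
      have : η⁻¹ / 2 * (η * ‖z s‖ - ‖x‖) ^ 2 =
          η / 2 * ‖z s‖ ^ 2 + η⁻¹ / 2 * ‖x‖ ^ 2 - ‖x‖ * ‖z s‖ := by field_simp; ring
      linarith
    calc ρ (t - s) * inner ℝ x (z s) ≤ |ρ (t - s)| * |inner ℝ x (z s)| := by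
          rw [← abs_mul]; exact le_abs_self _
      _ ≤ (σ * -kern (-α) (t - s)) * (η / 2 * ‖z s‖ ^ 2 + η⁻¹ / 2 * ‖x‖ ^ 2) :=
          mul_le_mul hb' ((abs_real_inner_le_norm _ _).trans hyoung) (abs_nonneg _)
            (mul_nonneg hσ (by linarith))
      _ = _ := by rw [smul_eq_mul]; ring
  rw [e1]
  refine e2.trans ?_
  rw [intervalIntegral.integral_add (i2.const_mul _) (i3.const_mul _),
    intervalIntegral.integral_const_mul, intervalIntegral.integral_const_mul,
    integral_kern_neg hb hbt]
  have hk0 := kern_nonneg (sub_pos.2 hα1) (hb.trans hbt.le)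
  have : 0 ≤ σ / 2 * η⁻¹ * ‖x‖ ^ 2 * kern (1 - α) t := by positivity
  linarith

theorem integral_inner_history_le [CompleteSpace E] {z e : ℝ → E} (hz : z ∈ pwPoly E)
    (he : e ∈ pwPoly E) {α : ℝ} (hα0 : 0 < α) (hα1 : α < 1) {ρ : ℝ → ℝ}
    (hρ : ContinuousOn ρ (Ioi 0)) {σ η b c d : ℝ}
    (hσ : 0 ≤ σ) (hη : 0 < η) (hb : 0 ≤ b) (hbc : b < c) (hcd : c ≤ d)
    (hbound : ∀ x ∈ Icc (c - b) d, |ρ x| ≤ σ * |kern (-α) x|) :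
    ∫ t in c..d, inner ℝ (∫ s in (0 : ℝ)..b, ρ (t - s) • z s) (e t) ≤
      σ / 2 * (η * ((∫ s in (0 : ℝ)..b, kern (1 - α) (c - s) • ‖z s‖ ^ 2) -
          ∫ s in (0 : ℝ)..b, kern (1 - α) (d - s) • ‖z s‖ ^ 2) +
        η⁻¹ * (kern (1 - α) (c - b) * ∫ t in c..d, ‖e t‖ ^ 2)) := by
  have hz2 := pwPoly_norm_sq hz
  have i1 := pwPoly_inner_intervalIntegrable
    (integral_comp_sub_intervalIntegrable hz hρ hb hbc hcd) he
  have i2 : IntervalIntegrable (fun t => -∫ s in (0 : ℝ)..b, kern (-α) (t - s) • ‖z s‖ ^ 2)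
      volume c d :=
    (integral_comp_sub_intervalIntegrable hz2 (kern_continuousOn (-α)) hb hbc hcd).neg
  have i3 := pwPoly_norm_sq_intervalIntegrable he c d
  have h := integral_integral_kern hz2 α hb hbc hcd
  rw [← neg_sub (∫ s in (0 : ℝ)..b, kern (1 - α) (d - s) • ‖z s‖ ^ 2), ← h,
    ← intervalIntegral.integral_neg, ← intervalIntegral.integral_const_mul,
    ← intervalIntegral.integral_const_mul, ← intervalIntegral.integral_const_mul,
    ← intervalIntegral.integral_add (i2.const_mul _) ((i3.const_mul _).const_mul _),
    ← intervalIntegral.integral_const_mul]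
  refine intervalIntegral.integral_mono_on hcd i1
    (((i2.const_mul _).add ((i3.const_mul _).const_mul _)).const_mul _) fun t ht => ?_
  refine (inner_integral_comp_sub_le hz (e t) hα0 hα1 hρ hσ hη hb (hbc.trans_le ht.1)
    fun s hs => hbound _ ⟨by linarith [hs.2, ht.1], by linarith [hs.1, ht.2]⟩).trans ?_
  have := kern_antitone (sub_pos.2 hα1) (by linarith) (s := c - b) (t := t - b) (by linarith)
    (by linarith [ht.1])
  gcongr

end

section

/-! ### Abstract stability and error estimates -/

variable {E : Type*} [NormedAddCommGroup E] [InnerProductSpace ℝ E] [CompleteSpace E]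


/-- Stability: the `L²` norm of a function whose energy is bounded by the work of the load. -/
theorem norm_sq_le_of_energy_le {u f : ℝ → E} {u₀ : E} (hu : u ∈ pwPoly E) {α T : ℝ}
    (hα0 : 0 < α) (hα1 : α < 1) (hT : 0 < T) (hf : MemLp f 2 (volume.restrict (Ioc 0 T)))
    (h : ∫ t in (0 : ℝ)..T, inner ℝ (rlDeriv 0 α u t) (u t) ≤
      ∫ t in (0 : ℝ)..T, inner ℝ (f t + kern (1 - α) t • u₀) (u t)) :
    kern (1 - α) T / 4 * ∫ t in (0 : ℝ)..T, ‖u t‖ ^ 2 ≤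
      ‖u₀‖ ^ 2 / 2 * (∫ t in (0 : ℝ)..T, kern (1 - α) t) +
        (kern (1 - α) T)⁻¹ * ∫ t in (0 : ℝ)..T, ‖f t‖ ^ 2 := by
  have hβ : 0 < 1 - α := sub_pos.2 hα1
  have hk := kern_pos hβ hT
  set k := kern (1 - α) T with hkdef
  have hE := energy_le_integral_rlDeriv hu hα0 hα1 le_rfl hT.le
  rw [fracInt_self, sub_zero] at hE
  have hG := kern_mul_integral_le_fracInt hu hβ (by linarith) hT.le
  have if1 : IntervalIntegrable f volume 0 T :=
    (intervalIntegrable_iff_integrableOn_Ioc_of_le hT.le).2 (hf.integrable one_le_two)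
  have if2 : IntervalIntegrable (fun t => ‖f t‖ ^ 2) volume 0 T :=
    (intervalIntegrable_iff_integrableOn_Ioc_of_le hT.le).2
      ((memLp_two_iff_integrable_sq_norm hf.1).1 hf)
  have ik := kern_intervalIntegrable hβ 0 T
  have ik0 : IntervalIntegrable (fun t => kern (1 - α) t • u₀) volume 0 T := by
    rw [intervalIntegrable_iff] at ik ⊢
    exact ik.smul_const u₀
  have i1 := pwPoly_inner_intervalIntegrable (if1.add ik0) hu
  have i2 := pwPoly_norm_sq_intervalIntegrable hu 0 T
  have i3 := pwPoly_kern_norm_sq_intervalIntegrable hu hβ 0 T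
  have hle : ∫ t in (0 : ℝ)..T, inner ℝ (f t + kern (1 - α) t • u₀) (u t) ≤
      ∫ t in (0 : ℝ)..T, ((‖u₀‖ ^ 2 / 2 * kern (1 - α) t + 1 / 2 * (kern (1 - α) t * ‖u t‖ ^ 2)) +
        (k⁻¹ * ‖f t‖ ^ 2 + k / 4 * ‖u t‖ ^ 2)) := by
    refine intervalIntegral.integral_mono_on hT.le i1
      (((ik.const_mul _).add (i3.const_mul _)).add ((if2.const_mul _).add (i2.const_mul _)))
      fun t ht => ?_
    have hkt := kern_nonneg hβ ht.1
    rw [inner_add_left, real_inner_smul_left]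
    -- The weight `k / 4` uses half of the bound on `∫ ‖u‖²` coming from the fractional integral at
    -- `T`.
    have a1 : inner ℝ (f t) (u t) ≤ k⁻¹ * ‖f t‖ ^ 2 + k / 4 * ‖u t‖ ^ 2 := by
      refine (real_inner_le_norm _ _).trans ?_
      have h0 : 0 ≤ k⁻¹ * (‖f t‖ - k / 2 * ‖u t‖) ^ 2 := by positivity
      have e : k⁻¹ * (‖f t‖ - k / 2 * ‖u t‖) ^ 2 =
          k⁻¹ * ‖f t‖ ^ 2 + k / 4 * ‖u t‖ ^ 2 - ‖f t‖ * ‖u t‖ := by field_simp; ring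
      linarith
    -- Multiplied by the singular kernel, the `‖u t‖²` half is exactly what the kernel-weighted term
    -- of the energy inequality absorbs.
    have a2 : inner ℝ u₀ (u t) ≤ ‖u₀‖ ^ 2 / 2 + ‖u t‖ ^ 2 / 2 := by
      refine (real_inner_le_norm _ _).trans ?_
      linarith [sq_nonneg (‖u₀‖ - ‖u t‖)]
    have a3 := mul_le_mul_of_nonneg_left a2 hkt
    linarith
  rw [intervalIntegral.integral_add ((ik.const_mul _).add (i3.const_mul _))
      ((if2.const_mul _).add (i2.const_mul _)),
    intervalIntegral.integral_add (ik.const_mul _) (i3.const_mul _),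
    intervalIntegral.integral_add (if2.const_mul _) (i2.const_mul _)] at hle
  simp only [intervalIntegral.integral_const_mul] at hle
  linarith

/-- The energy of the error is bounded by the history terms, which telescope. -/
theorem integral_rlDeriv_error_le {z e : ℝ → E} (hz : z ∈ pwPoly E)
    (he : e ∈ pwPoly E) {α : ℝ} (hα0 : 0 < α) (hα1 : α < 1) {ρ : ℝ → ℝ}
    (hρ : ContinuousOn ρ (Ioi 0)) {σ η : ℝ} (hσ : 0 ≤ σ) (hη : 0 < η)
    {t : ℕ → ℝ} {N : ℕ} (ht0 : t 0 = 0) (ht1 : 0 < t 1) (hstep : ∀ n, t n + t 1 ≤ t (n + 1))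
    (hbound : ∀ x ∈ Icc (t 1) (t N), |ρ x| ≤ σ * |kern (-α) x|)
    (hzero : ∀ s ∈ Ioc 0 (t 2), e s = 0)
    (hineq : ∀ i, 1 ≤ i → i + 2 ≤ N →
      ∫ τ in t (i + 1)..t (i + 2), inner ℝ (rlDeriv 0 α e τ) (e τ) ≤
        ∫ τ in t (i + 1)..t (i + 2), inner ℝ (∫ s in (0 : ℝ)..t i, ρ (τ - s) • z s) (e τ))
    (m : ℕ) (hm : m + 2 ≤ N) :
    ∫ τ in (0 : ℝ)..t (m + 2), inner ℝ (rlDeriv 0 α e τ) (e τ) ≤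
      σ / 2 * (η * (kern (1 - α) (t 1) * (∫ s in (0 : ℝ)..t (m + 1), ‖z s‖ ^ 2) -
          ∫ s in (0 : ℝ)..t (m + 1), kern (1 - α) (t (m + 2) - s) • ‖z s‖ ^ 2) +
        η⁻¹ * (kern (1 - α) (t 1) * ∫ τ in (0 : ℝ)..t (m + 2), ‖e τ‖ ^ 2)) := by
  have hβ : 0 < 1 - α := sub_pos.2 hα1
  have hz2 := pwPoly_norm_sq hz
  have hmono : Monotone t := monotone_nat_of_le_succ fun n => by linarith [hstep n]
  have hnn : ∀ n, 0 ≤ t n := fun n => ht0 ▸ hmono (Nat.zero_le n)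
  have iz := pwPoly_norm_sq_intervalIntegrable hz
  have ie := pwPoly_norm_sq_intervalIntegrable he
  have ik := fun τ => pwPoly_kern_intervalIntegrable hz2 hβ τ
  -- When the history grows by one cell, that cell is still at least one step, hence at least `t 1`,
  -- away from the new endpoint.
  have hcell : ∀ n, ∫ s in t n..t (n + 1), kern (1 - α) (t (n + 2) - s) • ‖z s‖ ^ 2 ≤
      kern (1 - α) (t 1) * ∫ s in t n..t (n + 1), ‖z s‖ ^ 2 := by
    intro n
    rw [← intervalIntegral.integral_const_mul]
    refine intervalIntegral.integral_mono_on (hmono n.le_succ) (ik _ _ _)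
      ((iz _ _).const_mul _) fun s hs => ?_
    exact mul_le_mul_of_nonneg_right
      (kern_antitone hβ (by linarith) ht1 (by linarith [hs.2, hstep (n + 1)])) (by positivity)
  induction m with
  -- The error vanishes up to `t 2`, so only nonnegativity of the right side is needed, and `hcell
  -- 0` gives it.
  | zero =>
    have e1 : ∫ τ in (0 : ℝ)..t (0 + 2), inner ℝ (rlDeriv 0 α e τ) (e τ) = 0 := by
      rw [intervalIntegral.integral_congr_Ioo_of_le (g := fun _ => 0) (hnn _)
        fun s hs => by simp [hzero s ⟨hs.1, hs.2.le⟩]]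
      simp
    have h0 := hcell 0
    simp only [ht0, zero_add] at h0
    have hE : 0 ≤ ∫ τ in (0 : ℝ)..t (0 + 2), ‖e τ‖ ^ 2 :=
      intervalIntegral.integral_nonneg (hnn _) fun _ _ => by positivity
    have hk := (kern_pos hβ ht1).le
    rw [e1]
    have h1 := sub_nonneg.2 h0
    simp only [zero_add] at hE ⊢
    positivity
  | succ m ih =>
    have ih := ih (by omega)
    have hb := integral_inner_history_le hz he hα0 hα1 hρ hσ hη (hnn (m + 1))
      (show t (m + 1) < t (m + 2) by linarith [hstep (m + 1)])
      (show t (m + 2) ≤ t (m + 3) from hmono (by omega))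
      (fun x hx => hbound x ⟨by linarith [hx.1, hstep (m + 1)], hx.2.trans (hmono hm)⟩)
    have hi := (hineq (m + 1) (by omega) hm).trans hb
    have hkle : kern (1 - α) (t (m + 2) - t (m + 1)) ≤ kern (1 - α) (t 1) :=
      kern_antitone hβ (by linarith) ht1 (by linarith [hstep (m + 1)])
    have hEcell : 0 ≤ ∫ τ in t (m + 2)..t (m + 3), ‖e τ‖ ^ 2 :=
      intervalIntegral.integral_nonneg (hmono (by omega)) fun _ _ => by positivity
    have hi' := rlDeriv_inner_intervalIntegrable he he hα1 le_rfl (hnn (m + 2))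
    have hi'' := rlDeriv_inner_intervalIntegrable he he hα1 (hnn (m + 2))
      (show t (m + 2) ≤ t (m + 3) from hmono (by omega))
    have s1 := intervalIntegral.integral_add_adjacent_intervals hi' hi''
    have s2 := intervalIntegral.integral_add_adjacent_intervals (ie 0 (t (m + 2)))
      (ie (t (m + 2)) (t (m + 3)))
    have s3 := intervalIntegral.integral_add_adjacent_intervals (iz 0 (t (m + 1)))
      (iz (t (m + 1)) (t (m + 2)))
    have s4 := intervalIntegral.integral_add_adjacent_intervals
      (ik (t (m + 3)) 0 (t (m + 1))) (ik (t (m + 3)) (t (m + 1)) (t (m + 2)))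
    have hc := hcell (m + 1)
    have b1 := mul_le_mul_of_nonneg_right hkle hEcell
    have hmain := add_le_add ih hi
    -- The subtracted convolution at `t (m + 2)` in the induction hypothesis cancels the positive
    -- one from the new interval. The convolution at `t (m + 3)` over the added cell is paid for by
    -- `hc`.
    simp only [add_assoc, Nat.reduceAdd] at hmain hc s1 s2 s3 s4 b1 ⊢
    rw [s1] at hmain
    rw [← s2, ← s3, ← s4]
    refine hmain.trans ?_
    rw [← mul_add]
    refine mul_le_mul_of_nonneg_left ?_ (by positivity)
    have b2 := mul_le_mul_of_nonneg_left b1 (inv_pos.2 hη).le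
    have b3 := mul_le_mul_of_nonneg_left hc hη.le
    simp only [smul_eq_mul] at *
    linarith

/-- The abstract error estimate. -/
theorem error_norm_sq_le {u z : ℝ → E} (hu : u ∈ pwPoly E) (hz : z ∈ pwPoly E) {α : ℝ}
    (hα0 : 0 < α) (hα1 : α < 1) {ρ : ℝ → ℝ} (hρ : ContinuousOn ρ (Ioi 0)) {σ : ℝ} (hσ : 0 < σ)
    {t : ℕ → ℝ} {N : ℕ} (ht0 : t 0 = 0) (ht1 : 0 < t 1) (hstep : ∀ n, t n + t 1 ≤ t (n + 1))
    (hbound : ∀ x ∈ Icc (t 1) (t N), |ρ x| ≤ σ * |kern (-α) x|)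
    (hzero : ∀ s ∈ Ioc 0 (t 2), s ≤ t N → u s = z s)
    (hineq : ∀ i, 1 ≤ i → i + 2 ≤ N →
      ∫ τ in t (i + 1)..t (i + 2), inner ℝ (rlDeriv 0 α (u - z) τ) ((u - z) τ) ≤
        ∫ τ in t (i + 1)..t (i + 2), inner ℝ (∫ s in (0 : ℝ)..t i, ρ (τ - s) • z s) ((u - z) τ))
    (n : ℕ) (hn : 1 ≤ n) (hnN : n ≤ N) (hsmall : σ * (t n ^ α * t 1 ^ (-α)) ≤ 1 / 2) :
    ∫ τ in (0 : ℝ)..t n, ‖u τ - z τ‖ ^ 2 ≤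
      4 * (σ * (t n ^ α * t 1 ^ (-α))) ^ 2 * ∫ τ in (0 : ℝ)..t n, ‖u τ‖ ^ 2 := by
  have hβ : 0 < 1 - α := sub_pos.2 hα1
  have hmono : Monotone t := monotone_nat_of_le_succ fun n => by linarith [hstep n]
  have hnn : ∀ n, 0 ≤ t n := fun n => ht0 ▸ hmono (Nat.zero_le n)
  have htn : 0 < t n := ht1.trans_le (hmono hn)
  have hU : 0 ≤ ∫ τ in (0 : ℝ)..t n, ‖u τ‖ ^ 2 :=
    intervalIntegral.integral_nonneg htn.le fun _ _ => by positivity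
  rcases Nat.lt_or_ge n 2 with hn2 | hn2
  -- Here `n = 1`, and the two functions coincide on the first interval.
  · have e1 : ∫ τ in (0 : ℝ)..t n, ‖u τ - z τ‖ ^ 2 = 0 := by
      rw [intervalIntegral.integral_congr_Ioo_of_le (g := fun _ => 0) htn.le fun s hs => by
        simp [hzero s ⟨hs.1, hs.2.le.trans (hmono hn2.le)⟩ (hs.2.le.trans (hmono hnN))]]
      simp
    rw [e1]
    positivity
  obtain ⟨m, rfl⟩ : ∃ m, n = m + 2 := ⟨n - 2, by omega⟩
  have he : u - z ∈ pwPoly E := (pwPoly E).sub_mem hu hz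
  set e := u - z with hedef
  set q := σ * (t (m + 2) ^ α * t 1 ^ (-α)) with hq
  have hqpos : 0 < q := by
    have := Real.rpow_pos_of_pos htn α
    have := Real.rpow_pos_of_pos ht1 (-α)
    positivity
  -- This identity dictates `q`: it trades the kernel at `t 1` from the history bound for the kernel
  -- at `t (m + 2)` from coercivity.
  have hratio : σ * kern (1 - α) (t 1) = q * kern (1 - α) (t (m + 2)) := by
    have h1 : t (m + 2) ^ α * t (m + 2) ^ (-α) = 1 := by
      rw [← Real.rpow_add htn, add_neg_cancel, Real.rpow_zero]
    simp only [kern, hq, show 1 - α - 1 = -α by ring]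
    calc σ * (t 1 ^ (-α) / Real.Gamma (1 - α)) =
        σ * (t (m + 2) ^ α * t (m + 2) ^ (-α)) * t 1 ^ (-α) / Real.Gamma (1 - α) := by
          rw [h1]; ring
      _ = _ := by ring
  have hzero' : ∀ s ∈ Ioc 0 (t 2), e s = 0 := fun s hs =>
    sub_eq_zero.2 (hzero s hs (hs.2.trans (hmono (hn2.trans hnN))))
  -- The Young weight is `η = q`, which leaves half of `∫ ‖e‖²` on the right.
  have h1 := integral_rlDeriv_error_le hz he hα0 hα1 hρ hσ.le hqpos ht0 ht1 hstep hbound hzero'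
    hineq m hnN
  have h2 := energy_le_integral_rlDeriv he hα0 hα1 le_rfl htn.le
  rw [fracInt_self, sub_zero] at h2
  have h3 := kern_mul_integral_le_fracInt he hβ (by linarith) htn.le
  have h4 := kern_mul_integral_le he hβ (by linarith) htn.le
  have iz := pwPoly_norm_sq_intervalIntegrable hz
  have hZmono : ∫ s in (0 : ℝ)..t (m + 1), ‖z s‖ ^ 2 ≤ ∫ s in (0 : ℝ)..t (m + 2), ‖z s‖ ^ 2 := by
    rw [← intervalIntegral.integral_add_adjacent_intervals (iz 0 (t (m + 1)))
      (iz (t (m + 1)) (t (m + 2)))]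
    exact le_add_of_nonneg_right
      (intervalIntegral.integral_nonneg (hmono (by omega)) fun _ _ => by positivity)
  have hΦ : 0 ≤ ∫ s in (0 : ℝ)..t (m + 1), kern (1 - α) (t (m + 2) - s) • ‖z s‖ ^ 2 := by
    refine intervalIntegral.integral_nonneg (hnn _) fun s hs => ?_
    have := kern_nonneg hβ (t := t (m + 2) - s)
      (by linarith [hs.2, hmono (show m + 1 ≤ m + 2 by omega)])
    rw [smul_eq_mul]
    positivity
  have hZ : ∫ s in (0 : ℝ)..t (m + 2), ‖z s‖ ^ 2 ≤ 2 * (∫ s in (0 : ℝ)..t (m + 2), ‖u s‖ ^ 2) +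
      2 * ∫ s in (0 : ℝ)..t (m + 2), ‖e s‖ ^ 2 := by
    have iu := pwPoly_norm_sq_intervalIntegrable hu 0 (t (m + 2))
    have ie := pwPoly_norm_sq_intervalIntegrable he 0 (t (m + 2))
    rw [← intervalIntegral.integral_const_mul, ← intervalIntegral.integral_const_mul,
      ← intervalIntegral.integral_add (iu.const_mul _) (ie.const_mul _)]
    refine intervalIntegral.integral_mono_on htn.le (iz _ _)
      ((iu.const_mul _).add (ie.const_mul _)) fun s _ => ?_
    have : z s = u s - e s := by simp [hedef]
    rw [this]
    have := parallelogram_law_with_norm ℝ (u s) (e s)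
    nlinarith [sq_nonneg ‖u s + e s‖]
  have hEe : ∫ τ in (0 : ℝ)..t (m + 2), ‖u τ - z τ‖ ^ 2 =
    ∫ s in (0 : ℝ)..t (m + 2), ‖e s‖ ^ 2 := rfl
  rw [hEe]
  have hEnn : 0 ≤ ∫ s in (0 : ℝ)..t (m + 2), ‖e s‖ ^ 2 :=
    intervalIntegral.integral_nonneg htn.le fun _ _ => by positivity
  have hk := kern_pos hβ htn
  have hk1 := kern_pos hβ ht1
  generalize (∫ s in (0 : ℝ)..t (m + 2), ‖e s‖ ^ 2) = R at *
  generalize (∫ s in (0 : ℝ)..t (m + 2), ‖z s‖ ^ 2) = Z at *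
  generalize (∫ s in (0 : ℝ)..t (m + 2), ‖u s‖ ^ 2) = W at *
  generalize (∫ s in (0 : ℝ)..t (m + 1), kern (1 - α) (t (m + 2) - s) • ‖z s‖ ^ 2) = Φ at *
  generalize (∫ s in (0 : ℝ)..t (m + 1), ‖z s‖ ^ 2) = Z' at *
  have h5 : kern (1 - α) (t (m + 2)) * R ≤
      σ / 2 * (q * (kern (1 - α) (t 1) * Z) + q⁻¹ * (kern (1 - α) (t 1) * R)) := by
    have a : q * (kern (1 - α) (t 1) * Z' - Φ) ≤ q * (kern (1 - α) (t 1) * Z) := by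
      refine mul_le_mul_of_nonneg_left ?_ hqpos.le
      linarith [mul_le_mul_of_nonneg_left hZmono hk1.le]
    have b := mul_le_mul_of_nonneg_left (add_le_add_left a
      (q⁻¹ * (kern (1 - α) (t 1) * R))) (show 0 ≤ σ / 2 by positivity)
    linarith
  have h6 : σ / 2 * (q * (kern (1 - α) (t 1) * Z) + q⁻¹ * (kern (1 - α) (t 1) * R)) =
      kern (1 - α) (t (m + 2)) * (q ^ 2 * Z / 2 + R / 2) := by
    calc _ = (σ * kern (1 - α) (t 1)) * (q * Z + q⁻¹ * R) / 2 := by ring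
      _ = _ := by rw [hratio]; field_simp
  rw [h6] at h5
  have h7 := le_of_mul_le_mul_left h5 hk
  have hq2 : q ^ 2 ≤ 1 / 4 := by nlinarith
  have h8 : q ^ 2 * Z ≤ q ^ 2 * (2 * W + 2 * R) := mul_le_mul_of_nonneg_left hZ (by positivity)
  have h9 : q ^ 2 * R ≤ 1 / 4 * R := mul_le_mul_of_nonneg_right hq2 hEnn
  linarith

end

/-! ### The graded grid -/

theorem grid_zero {T r : ℝ} (hr : 1 ≤ r) (N : ℕ) : grid T r N 0 = 0 := by
  simp [grid, Real.zero_rpow (by linarith : r ≠ 0)]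

theorem grid_self (T r : ℝ) {N : ℕ} (hN : 1 ≤ N) : grid T r N N = T := by
  have : (N : ℝ) ≠ 0 := by positivity
  simp [grid, this]

theorem grid_one_pos {T r : ℝ} (hT : 0 < T) {N : ℕ} (hN : 1 ≤ N) : 0 < grid T r N 1 := by
  unfold grid
  positivity

theorem grid_eq {T r : ℝ} (N n : ℕ) : grid T r N n = (n : ℝ) ^ r * grid T r N 1 := by
  simp only [grid, Nat.cast_one]
  rw [div_eq_mul_one_div, Real.mul_rpow (by positivity) (by positivity), mul_assoc]

/-- Superadditivity of `x ^ r` for `r ≥ 1`: no step is shorter than the first. This keeps the lags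
in the remote history above `δ`. -/
theorem grid_add_grid_one_le {T r : ℝ} (hT : 0 ≤ T) (hr : 1 ≤ r) (N n : ℕ) :
    grid T r N n + grid T r N 1 ≤ grid T r N (n + 1) := by
  have h1 : 0 ≤ grid T r N 1 := by unfold grid; positivity
  have := Real.add_rpow_le_rpow_add (Nat.cast_nonneg (α := ℝ) n) zero_le_one hr
  rw [Real.one_rpow] at this
  rw [grid_eq N n, grid_eq N (n + 1), Nat.cast_add, Nat.cast_one]
  nlinarith

theorem grid_monotone {T r : ℝ} (hT : 0 ≤ T) (hr : 1 ≤ r) (N : ℕ) : Monotone (grid T r N) :=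
  monotone_nat_of_le_succ fun n => by
    have h1 : 0 ≤ grid T r N 1 := by unfold grid; positivity
    linarith [grid_add_grid_one_le hT hr N n]

theorem grid_nonneg {T : ℝ} (hT : 0 ≤ T) (r : ℝ) (N n : ℕ) : 0 ≤ grid T r N n := by
  unfold grid
  positivity

theorem grid_rpow_mul_grid_one_rpow {T r : ℝ} (hT : 0 < T) {N : ℕ} (hN : 1 ≤ N) (n : ℕ) (α : ℝ) :
    grid T r N n ^ α * grid T r N 1 ^ (-α) = (n : ℝ) ^ (r * α) := by
  have h1 := grid_one_pos (r := r) hT hN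
  rw [grid_eq, Real.mul_rpow (by positivity) h1.le, mul_assoc, ← Real.rpow_add h1, add_neg_cancel,
    Real.rpow_zero, mul_one, ← Real.rpow_mul (by positivity)]

/-! ### Trial functions are piecewise polynomials -/

/-- A trial function is unrestricted outside `(0, T]`. Passing to a piecewise polynomial
representative makes measurability and integrability available. -/
theorem exists_pwPoly_eq {V : Type*} [AddCommGroup V] [Module ℝ V] {T r : ℝ} (hT : 0 ≤ T)
    (hr : 1 ≤ r) {N p : ℕ} {S : Submodule ℝ V} {v : ℝ → V} (hv : IsTrial T r N p S v) :
    ∃ w ∈ pwPoly V, ∀ s ∈ Ioc 0 (grid T r N N), v s = w s := by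
  -- Vanishing beyond the current node lets the next polynomial piece be added without correction.
  suffices H : ∀ n ≤ N, ∃ w ∈ pwPoly V, (∀ s ∈ Ioc 0 (grid T r N n), v s = w s) ∧
      ∀ s, grid T r N n < s → w s = 0 by
    obtain ⟨w, hw, h, -⟩ := H N le_rfl
    exact ⟨w, hw, h⟩
  intro n
  induction n with
  | zero => exact fun _ => ⟨0, zero_mem _, by simp [grid_zero hr], by simp⟩
  | succ n ih =>
    intro hn
    obtain ⟨w, hw, h1, h2⟩ := ih (by omega)
    obtain ⟨a, -, ha⟩ := hv (n + 1) (by omega) hn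
    rw [Nat.add_sub_cancel] at ha
    have hmono := grid_monotone hT hr N n.le_succ
    refine ⟨w + ∑ k ∈ Finset.range (p + 1), (Ioc (grid T r N n) (grid T r N (n + 1))).indicator
      fun s => ((Polynomial.X : Polynomial ℝ) ^ k).eval s • a k, Submodule.add_mem _ hw
        (Submodule.sum_mem _ fun k _ => indicator_Ioc_mem_pwPoly (grid_nonneg hT r N n) hmono _ _),
      fun s hs => ?_, fun s hs => ?_⟩
    · rw [Pi.add_apply, Finset.sum_apply]
      by_cases h : s ≤ grid T r N n
      · rw [h1 s ⟨hs.1, h⟩, Finset.sum_eq_zero, add_zero]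
        exact fun k _ => indicator_of_notMem (fun h' => absurd h'.1 (not_lt.2 h)) _
      · have hmem : s ∈ Ioc (grid T r N n) (grid T r N (n + 1)) := ⟨not_le.1 h, hs.2⟩
        rw [h2 s (not_le.1 h), zero_add, ha s hmem]
        refine Finset.sum_congr rfl fun k _ => ?_
        rw [indicator_of_mem hmem, Polynomial.eval_pow, Polynomial.eval_X]
    · rw [Pi.add_apply, Finset.sum_apply, h2 s (hmono.trans_lt hs), zero_add]
      exact Finset.sum_eq_zero fun k _ =>
        indicator_of_notMem (fun h' => absurd h'.2 (not_le.2 hs)) _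

theorem rlDeriv_congr {V : Type*} [NormedAddCommGroup V] [NormedSpace ℝ V] {v w : ℝ → V} {T : ℝ}
    (h : ∀ s ∈ Ioc 0 T, v s = w s) {a : ℝ} (ha : 0 ≤ a) (α : ℝ) {t : ℝ} (hat : a < t)
    (htT : t < T) : rlDeriv a α v t = rlDeriv a α w t := by
  refine Filter.EventuallyEq.deriv_eq ?_
  filter_upwards [Ioi_mem_nhds hat, Iio_mem_nhds htT] with τ h1 h2
  refine intervalIntegral.integral_congr_Ioo_of_le (mem_Ioi.1 h1).le fun s hs => ?_
  rw [h s ⟨ha.trans_lt hs.1, hs.2.le.trans (mem_Iio.1 h2).le⟩]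

theorem IsTimePolyOn.sub {V : Type*} [AddCommGroup V] [Module ℝ V] {p : ℕ} {S : Submodule ℝ V}
    {I : Set ℝ} {v w : ℝ → V} (hv : IsTimePolyOn p S I v) (hw : IsTimePolyOn p S I w) :
    IsTimePolyOn p S I fun t => v t - w t := by
  obtain ⟨a, ha, hva⟩ := hv
  obtain ⟨b, hb, hwb⟩ := hw
  refine ⟨a - b, fun k => S.sub_mem (ha k) (hb k), fun t ht => ?_⟩
  beta_reduce
  rw [hva t ht, hwb t ht, ← Finset.sum_sub_distrib]
  simp [smul_sub]

/-! ### The discrete history -/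

section History

variable {E : Type*} [NormedAddCommGroup E] [InnerProductSpace ℝ E] [CompleteSpace E]

/-- The exponents combine: `(c - b) + (t - c) + (b - s) = t - s`. So the recursively stored history
is a genuine exponential convolution. -/
theorem exp_history_eq {z x : ℝ → E} (hx : x ∈ pwPoly E) (l b c d : ℝ) :
    Real.exp (-l * (c - b)) * inner ℝ (∫ t in c..d, Real.exp (-l * (t - c)) • x t)
      (∫ s in (0 : ℝ)..b, Real.exp (-l * (b - s)) • z s) =
    ∫ t in c..d, inner ℝ (∫ s in (0 : ℝ)..b, Real.exp (-l * (t - s)) • z s) (x t) := by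
  set Y := ∫ s in (0 : ℝ)..b, Real.exp (-l * (b - s)) • z s with hY
  have hx' : IntervalIntegrable (fun t => Real.exp (-l * (t - c)) • x t) volume c d :=
    pwPoly_smul_intervalIntegrable hx
      (by fun_prop : Continuous fun t => Real.exp (-l * (t - c))).continuousOn.intervalIntegrable
  have h1 := (innerSL ℝ Y).intervalIntegral_comp_comm hx'
  simp only [innerSL_apply_apply] at h1
  rw [real_inner_comm, ← h1, ← intervalIntegral.integral_const_mul]
  refine intervalIntegral.integral_congr fun t _ => ?_
  have h2 : ∫ s in (0 : ℝ)..b, Real.exp (-l * (t - s)) • z s = Real.exp (-l * (t - b)) • Y := by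
    rw [hY, ← intervalIntegral.integral_smul]
    refine intervalIntegral.integral_congr fun s _ => ?_
    simp only [smul_smul, ← Real.exp_add]
    ring_nf
  simp only [h2, real_inner_smul_left, inner_smul_right, ← mul_assoc, ← Real.exp_add]
  ring_nf

theorem continuousOn_sum_exp_sub_kern {Q : ℕ} (w lam : Fin Q → ℝ) (α : ℝ) :
    ContinuousOn (fun x => ∑ j, w j * Real.exp (-(lam j) * x) - kern (-α) x) (Ioi 0) :=
  ContinuousOn.sub (by fun_prop) (kern_continuousOn _)

theorem sum_exp_history_sub_eq {z x : ℝ → E} (hz : z ∈ pwPoly E) (hx : x ∈ pwPoly E) {Q : ℕ}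
    (w lam : Fin Q → ℝ) (α : ℝ) {b c d : ℝ} (hb : 0 ≤ b) (hbc : b < c) (hcd : c ≤ d) :
    ∑ j, w j * Real.exp (-(lam j) * (c - b)) *
        inner ℝ (∫ t in c..d, Real.exp (-(lam j) * (t - c)) • x t)
          (∫ s in (0 : ℝ)..b, Real.exp (-(lam j) * (b - s)) • z s) -
      ∫ t in c..d, inner ℝ (∫ s in (0 : ℝ)..b, kern (-α) (t - s) • z s) (x t) =
    ∫ t in c..d, inner ℝ (∫ s in (0 : ℝ)..b,
      (∑ j, w j * Real.exp (-(lam j) * (t - s)) - kern (-α) (t - s)) • z s) (x t) := by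
  have hexp : ∀ j, ContinuousOn (fun y => Real.exp (-(lam j) * y)) (Ioi 0) :=
    fun j => by fun_prop
  have hk := kern_continuousOn (-α)
  have i1 : ∀ j, IntervalIntegrable (fun t => w j * inner ℝ
      (∫ s in (0 : ℝ)..b, Real.exp (-(lam j) * (t - s)) • z s) (x t)) volume c d := fun j =>
    (pwPoly_inner_intervalIntegrable
      (integral_comp_sub_intervalIntegrable hz (hexp j) hb hbc hcd) hx).const_mul _
  have i2 := pwPoly_inner_intervalIntegrable
    (integral_comp_sub_intervalIntegrable hz hk hb hbc hcd) hx
  simp only [mul_assoc, exp_history_eq hx, ← intervalIntegral.integral_const_mul]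
  rw [← intervalIntegral.integral_finsetSum fun j _ => i1 j, ← intervalIntegral.integral_sub
    (by simpa only [Finset.sum_fn] using IntervalIntegrable.sum Finset.univ fun j _ => i1 j) i2]
  refine intervalIntegral.integral_congr fun t ht => ?_
  rw [uIcc_of_le hcd] at ht
  have hbt := hbc.trans_le ht.1
  have j1 : ∀ j, IntervalIntegrable (fun s => w j • Real.exp (-(lam j) * (t - s)) • z s)
      volume 0 b := fun j => (pwPoly_comp_sub_intervalIntegrable hz (hexp j) hb hbt).smul (w j)
  have j2 := pwPoly_comp_sub_intervalIntegrable hz hk hb hbt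
  have e : ∫ s in (0 : ℝ)..b, (∑ j, w j * Real.exp (-(lam j) * (t - s)) - kern (-α) (t - s)) • z s =
      ∑ j, w j • (∫ s in (0 : ℝ)..b, Real.exp (-(lam j) * (t - s)) • z s) -
        ∫ s in (0 : ℝ)..b, kern (-α) (t - s) • z s := by
    simp only [← intervalIntegral.integral_smul, sub_smul, Finset.sum_smul, mul_smul]
    rw [← intervalIntegral.integral_finsetSum fun j _ => j1 j]
    exact intervalIntegral.integral_sub
      (by simpa only [Finset.sum_fn] using IntervalIntegrable.sum Finset.univ fun j _ => j1 j) j2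
  simp only [e, inner_sub_left, sum_inner, real_inner_smul_left]

theorem integral_inner_rlDeriv_sub {u z x : ℝ → E} (hu : u ∈ pwPoly E) (hz : z ∈ pwPoly E)
    (hx : x ∈ pwPoly E) {α : ℝ} (hα1 : α < 1) {a b : ℝ} (ha : 0 ≤ a) (hab : a ≤ b) :
    ∫ t in a..b, inner ℝ (rlDeriv 0 α (u - z) t) (x t) =
      (∫ t in a..b, inner ℝ (rlDeriv 0 α u t) (x t)) -
        ∫ t in a..b, inner ℝ (rlDeriv 0 α z t) (x t) := by
  have hβ : 0 < 1 - α := sub_pos.2 hα1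
  obtain ⟨S₁, hS₁, h₁⟩ := fracInt_differentiableAt hu hβ
  obtain ⟨S₂, hS₂, h₂⟩ := fracInt_differentiableAt hz hβ
  rw [← intervalIntegral.integral_sub (rlDeriv_inner_intervalIntegrable hu hx hα1 ha hab)
    (rlDeriv_inner_intervalIntegrable hz hx hα1 ha hab)]
  refine intervalIntegral.integral_congr_ae ?_
  filter_upwards [(hS₁.union hS₂).countable.ae_notMem volume] with t ht hmem
  rw [uIoc_of_le hab] at hmem
  simp only [mem_union, not_or] at ht
  have ht0 := ha.trans_lt hmem.1
  rw [← inner_sub_left]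
  congr 1
  unfold rlDeriv
  rw [fracInt_sub hu hz hβ]
  exact deriv_sub (h₁ t ht0 ht.1) (h₂ t ht0 ht.2)

theorem integral_inner_rlDeriv_eq_local_add_history {z x : ℝ → E} (hz : z ∈ pwPoly E)
    (hx : x ∈ pwPoly E) {α : ℝ} (hα1 : α < 1) {b c d : ℝ} (hb : 0 ≤ b) (hbc : b < c)
    (hcd : c ≤ d) :
    ∫ t in c..d, inner ℝ (rlDeriv b α z t) (x t) =
      (∫ t in c..d, inner ℝ (rlDeriv 0 α z t) (x t)) -
        ∫ t in c..d, inner ℝ (∫ s in (0 : ℝ)..b, kern (-α) (t - s) • z s) (x t) := by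
  obtain ⟨S, hS, h⟩ := rlDeriv_eq_local_add_history hz hα1
  rw [← intervalIntegral.integral_sub
    (rlDeriv_inner_intervalIntegrable hz hx hα1 (hb.trans hbc.le) hcd)
    (pwPoly_inner_intervalIntegrable
      (integral_comp_sub_intervalIntegrable hz (kern_continuousOn _) hb hbc hcd) hx)]
  refine intervalIntegral.integral_congr_ae ?_
  filter_upwards [hS.countable.ae_notMem volume] with t ht hmem
  rw [uIoc_of_le hcd] at hmem
  rw [← inner_sub_left, h b t hb (hbc.trans hmem.1) ht, add_sub_cancel_right]

end History

/-! ### The discrete solutions -/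

section Solutions

variable {d : ℕ} {Ω : Set (Space d)}

theorem pwPoly_fst {v : ℝ → FunGrad Ω} (hv : v ∈ pwPoly (FunGrad Ω)) :
    (fun s => (v s).1) ∈ pwPoly (L2 Ω) :=
  pwPoly_map hv (LinearMap.fst ℝ (L2 Ω) (L2Vec Ω))

theorem pwPoly_snd {v : ℝ → FunGrad Ω} (hv : v ∈ pwPoly (FunGrad Ω)) :
    (fun s => (v s).2) ∈ pwPoly (L2Vec Ω) :=
  pwPoly_map hv (LinearMap.snd ℝ (L2 Ω) (L2Vec Ω))

variable {α T r : ℝ} {N p : ℕ} {S : Submodule ℝ (FunGrad Ω)} {f : ℝ → L2 Ω} {u₀ : L2 Ω}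

/-- The discrete equation, with the solution and the test function replaced by piecewise
polynomials. -/
theorem IsDGSolution.equation {U : ℝ → FunGrad Ω} (hU : IsDGSolution α T r N p S f u₀ U)
    (hα1 : α < 1) (hT : 0 < T) (hr : 1 ≤ r) {u x : ℝ → FunGrad Ω} (hu : u ∈ pwPoly (FunGrad Ω))
    (hUu : ∀ s ∈ Ioc 0 (grid T r N N), U s = u s) (hx : x ∈ pwPoly (FunGrad Ω)) {n : ℕ}
    (hn : n < N)
    (hX : IsTimePolyOn p S (Ioc (grid T r N n) (grid T r N (n + 1))) x) :
    (∫ t in grid T r N n..grid T r N (n + 1),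
        inner ℝ (rlDeriv 0 α (fun s => (u s).1) t) (x t).1) +
      ∫ t in grid T r N n..grid T r N (n + 1), inner ℝ (u t).2 (x t).2 =
    loadForm α T r N f u₀ (n + 1) x := by
  have h := hU.2 (n + 1) (by omega) hn x (by rwa [Nat.add_sub_cancel])
  rw [Nat.add_sub_cancel] at h
  have h0 := grid_nonneg hT.le r N n
  have hmono := grid_monotone hT.le hr N
  have hle := hmono n.le_succ
  rw [← h, ← intervalIntegral.integral_add
    (rlDeriv_inner_intervalIntegrable (pwPoly_fst hu) (pwPoly_fst hx) hα1 h0 hle)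
    (pwPoly_intervalIntegrable (pwPoly_inner (pwPoly_snd hu) (pwPoly_snd hx)) _ _)]
  refine intervalIntegral.integral_congr_Ioo_of_le hle fun t ht => ?_
  have htN : t < grid T r N N := ht.2.trans_le (hmono hn)
  beta_reduce
  rw [hUu t ⟨h0.trans_lt ht.1, htN.le⟩,
    rlDeriv_congr (v := fun s => (U s).1) (w := fun s => (u s).1)
      (fun s hs => congrArg Prod.fst (hUu s hs)) le_rfl α (h0.trans_lt ht.1) htN]

/-- The fast scheme rewritten as the exact scheme with an added perturbation: the local derivative
is completed to the full one, and the true history thereby removed turns the sum of exponentials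
into the kernel error. -/
theorem IsFastDGSolution.equation {Q : ℕ} {w lam : Fin Q → ℝ} {U UF : ℝ → FunGrad Ω}
    (hF : IsFastDGSolution α T r N p S f u₀ w lam U UF)
    (hα1 : α < 1) (hT : 0 < T) (hr : 1 ≤ r) {z x : ℝ → FunGrad Ω} (hz : z ∈ pwPoly (FunGrad Ω))
    (hUz : ∀ s ∈ Ioc 0 (grid T r N N), UF s = z s) (hx : x ∈ pwPoly (FunGrad Ω)) {i : ℕ}
    (hi : 1 ≤ i) (hiN : i + 2 ≤ N)
    (hX : IsTimePolyOn p S (Ioc (grid T r N (i + 1)) (grid T r N (i + 2))) x) :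
    (∫ t in grid T r N (i + 1)..grid T r N (i + 2),
        inner ℝ (rlDeriv 0 α (fun s => (z s).1) t) (x t).1) +
      (∫ t in grid T r N (i + 1)..grid T r N (i + 2), inner ℝ (∫ s in (0 : ℝ)..grid T r N i,
        (∑ j, w j * Real.exp (-(lam j) * (t - s)) - kern (-α) (t - s)) • (z s).1) (x t).1) +
      ∫ t in grid T r N (i + 1)..grid T r N (i + 2), inner ℝ (z t).2 (x t).2 =
    loadForm α T r N f u₀ (i + 2) x := by
  have h := hF.2.2 (i + 2) (by omega) hiN x hX
  have e1 : i + 2 - 1 = i + 1 := rfl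
  have e2 : i + 2 - 2 = i := rfl
  rw [localForm, fastHistForm, e1, e2] at h
  have h0 := grid_nonneg hT.le r N i
  have hmono := grid_monotone hT.le hr N
  have hle : grid T r N (i + 1) ≤ grid T r N (i + 2) := hmono (by omega)
  have hN : 1 ≤ N := by omega
  have hlt : grid T r N i < grid T r N (i + 1) := by
    linarith [grid_add_grid_one_le hT.le hr N i, grid_one_pos (r := r) hT hN]
  have hiNle : grid T r N (i + 2) ≤ grid T r N N := hmono hiN
  have a1 : ∫ t in grid T r N (i + 1)..grid T r N (i + 2),
      inner ℝ (rlDeriv (grid T r N i) α (fun s => (UF s).1) t) (x t).1 =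
      ∫ t in grid T r N (i + 1)..grid T r N (i + 2),
        inner ℝ (rlDeriv (grid T r N i) α (fun s => (z s).1) t) (x t).1 := by
    refine intervalIntegral.integral_congr_Ioo_of_le hle fun t ht => ?_
    beta_reduce
    rw [rlDeriv_congr (v := fun s => (UF s).1) (w := fun s => (z s).1)
      (fun s hs => congrArg Prod.fst (hUz s hs)) h0 α (hlt.trans ht.1) (ht.2.trans_le hiNle)]
  have a2 : ∫ t in grid T r N (i + 1)..grid T r N (i + 2), inner ℝ (UF t).2 (x t).2 =
      ∫ t in grid T r N (i + 1)..grid T r N (i + 2), inner ℝ (z t).2 (x t).2 := by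
    refine intervalIntegral.integral_congr_Ioo_of_le hle fun t ht => ?_
    beta_reduce
    rw [hUz t ⟨(h0.trans_lt hlt).trans ht.1, ht.2.le.trans hiNle⟩]
  have a3 : ∀ j, histVar (lam j) UF (grid T r N i) =
      ∫ s in (0 : ℝ)..grid T r N i, Real.exp (-(lam j) * (grid T r N i - s)) • (z s).1 := by
    intro j
    refine intervalIntegral.integral_congr_Ioo_of_le h0 fun s hs => ?_
    beta_reduce
    rw [hUz s ⟨hs.1, hs.2.le.trans (hlt.le.trans (hle.trans hiNle))⟩]
  simp only [a3] at h
  have a4 := sum_exp_history_sub_eq (pwPoly_fst hz) (pwPoly_fst hx) w lam α h0 hlt hle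
  simp only [psiForm, e1] at h
  rw [a1, a2, integral_inner_rlDeriv_eq_local_add_history (pwPoly_fst hz) (pwPoly_fst hx) hα1 h0
    hlt hle] at h
  rw [← a4, ← h]
  ring

/-- Stability of the discontinuous Galerkin solution. -/
theorem IsDGSolution.norm_sq_le {U u : ℝ → FunGrad Ω} (hU : IsDGSolution α T r N p S f u₀ U)
    (hα0 : 0 < α) (hα1 : α < 1) (hT : 0 < T) (hr : 1 ≤ r) (hN : 1 ≤ N)
    (hf : MemLp f 2 (volume.restrict (Ioc 0 T))) (hu : u ∈ pwPoly (FunGrad Ω))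
    (hUu : ∀ s ∈ Ioc 0 (grid T r N N), U s = u s) :
    kern (1 - α) T / 4 * ∫ t in (0 : ℝ)..T, ‖(u t).1‖ ^ 2 ≤
      ‖u₀‖ ^ 2 / 2 * (∫ t in (0 : ℝ)..T, kern (1 - α) t) +
        (kern (1 - α) T)⁻¹ * ∫ t in (0 : ℝ)..T, ‖f t‖ ^ 2 := by
  have hu1 := pwPoly_fst hu
  have hu2 := pwPoly_snd hu
  refine norm_sq_le_of_energy_le hu1 hα0 hα1 hT hf ?_
  have hmono := grid_monotone hT.le hr N
  have hg0 := grid_nonneg hT.le r N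
  have if1 : IntervalIntegrable f volume 0 T :=
    (intervalIntegrable_iff_integrableOn_Ioc_of_le hT.le).2 (hf.integrable one_le_two)
  have ik := kern_intervalIntegrable (sub_pos.2 hα1) 0 T
  have ik0 : IntervalIntegrable (fun t => kern (1 - α) t • u₀) volume 0 T := by
    rw [intervalIntegrable_iff] at ik ⊢
    exact ik.smul_const u₀
  have i1 := pwPoly_inner_intervalIntegrable (if1.add ik0) hu1
  have i1' : ∀ n < N, IntervalIntegrable
      (fun t => inner ℝ (f t + kern (1 - α) t • u₀) (u t).1) volume
      (grid T r N n) (grid T r N (n + 1)) := fun n hn => by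
    refine i1.mono_set ?_
    rw [uIcc_of_le (hmono n.le_succ), uIcc_of_le hT.le]
    exact Icc_subset_Icc (hg0 n) ((hmono hn).trans_eq (grid_self T r hN))
  have s1 := intervalIntegral.sum_integral_adjacent_intervals fun n (_ : n < N) =>
    rlDeriv_inner_intervalIntegrable hu1 hu1 hα1 (hg0 n) (hmono n.le_succ)
  have s2 := intervalIntegral.sum_integral_adjacent_intervals i1'
  rw [grid_zero hr, grid_self T r hN] at s1 s2
  rw [← s1, ← s2]
  refine Finset.sum_le_sum fun n hn => ?_
  have hn := Finset.mem_range.1 hn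
  have hX : IsTimePolyOn p S (Ioc (grid T r N n) (grid T r N (n + 1))) u := by
    obtain ⟨a, ha, h⟩ := hU.1 (n + 1) (by omega) hn
    refine ⟨a, ha, fun t ht => ?_⟩
    rw [← hUu t ⟨(hg0 n).trans_lt ht.1, ht.2.trans (hmono hn)⟩]
    exact h t ht
  have h := hU.equation hα1 hT hr hu hUu hu hn hX
  -- With the solution itself as test function, the gradient term is nonnegative and can be
  -- discarded.
  have hpos : 0 ≤ ∫ t in grid T r N n..grid T r N (n + 1), inner ℝ (u t).2 (u t).2 :=
    intervalIntegral.integral_nonneg (hmono n.le_succ) fun t _ => real_inner_self_nonneg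
  rw [loadForm, Nat.add_sub_cancel] at h
  linarith

end Solutions

/-- The error of the fast method in terms of the norm of the discontinuous Galerkin solution. -/
theorem IsFastDGSolution.error_le {d : ℕ} {Ω : Set (Space d)} {α T r : ℝ} {N p : ℕ}
    {S : Submodule ℝ (FunGrad Ω)} {f : ℝ → L2 Ω} {u₀ : L2 Ω} {Q : ℕ} {w lam : Fin Q → ℝ}
    {U UF : ℝ → FunGrad Ω} (hF : IsFastDGSolution α T r N p S f u₀ w lam U UF)
    (hU : IsDGSolution α T r N p S f u₀ U) (hα0 : 0 < α) (hα1 : α < 1) (hT : 0 < T) (hr : 1 ≤ r)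
    (hN : 1 ≤ N) {δ σ : ℝ} (hδ : δ ≤ grid T r N 1) (hσ : 0 < σ)
    (hker : IsKernelApprox α δ T σ w lam) {u z : ℝ → FunGrad Ω} (hu : u ∈ pwPoly (FunGrad Ω))
    (hUu : ∀ s ∈ Ioc 0 (grid T r N N), U s = u s) (hz : z ∈ pwPoly (FunGrad Ω))
    (hUz : ∀ s ∈ Ioc 0 (grid T r N N), UF s = z s) {n : ℕ} (hn : 1 ≤ n) (hnN : n ≤ N)
    (hsmall : σ * (grid T r N n ^ α * grid T r N 1 ^ (-α)) ≤ 1 / 2) :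
    ∫ t in (0 : ℝ)..grid T r N n, ‖(u t).1 - (z t).1‖ ^ 2 ≤
      4 * (σ * (grid T r N n ^ α * grid T r N 1 ^ (-α))) ^ 2 *
        ∫ t in (0 : ℝ)..grid T r N n, ‖(u t).1‖ ^ 2 := by
  have hg0 := grid_nonneg hT.le r N
  have hmono := grid_monotone hT.le hr N
  refine error_norm_sq_le (pwPoly_fst hu) (pwPoly_fst hz) hα0 hα1
    (continuousOn_sum_exp_sub_kern w lam α) hσ (grid_zero hr N) (grid_one_pos hT hN)
    (grid_add_grid_one_le hT.le hr N) ?_ ?_ ?_ n hn hnN hsmall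
  · intro x hx
    obtain ⟨εhat, hε⟩ := hker
    obtain ⟨h1, h2⟩ := hε x ⟨hδ.trans hx.1, hx.2.trans_eq (grid_self T r hN)⟩
    have e : ∑ j, w j * Real.exp (-(lam j) * x) - kern (-α) x = -(εhat x * kern (-α) x) := by
      linarith
    rw [e, abs_neg, abs_mul]
    exact mul_le_mul_of_nonneg_right h1 (abs_nonneg _)
  · intro s hs hsN
    rw [← hUu s ⟨hs.1, hsN⟩, ← hUz s ⟨hs.1, hsN⟩,
      hF.2.1 s hs (hsN.trans_eq (grid_self T r hN))]
  · intro i hi hiN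
    have hx : u - z ∈ pwPoly (FunGrad Ω) := Submodule.sub_mem _ hu hz
    have hle : grid T r N (i + 1) ≤ grid T r N (i + 2) := hmono (by omega)
    -- The difference of the two discrete solutions lies in the test space on this interval.
    have hX : IsTimePolyOn p S (Ioc (grid T r N (i + 1)) (grid T r N (i + 2))) (u - z) := by
      obtain ⟨a, ha, h⟩ := (hU.1 (i + 2) (by omega) hiN).sub (hF.1 (i + 2) (by omega) hiN)
      refine ⟨a, ha, fun t ht => ?_⟩
      have hmem : t ∈ Ioc 0 (grid T r N N) := ⟨(hg0 (i + 1)).trans_lt ht.1, ht.2.trans (hmono hiN)⟩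
      rw [Pi.sub_apply, ← hUu t hmem, ← hUz t hmem]
      exact h t ht
    have h1 := hU.equation hα1 hT hr hu hUu hx (n := i + 1) hiN hX
    have h2 := hF.equation hα1 hT hr hz hUz hx hi hiN hX
    have hx1 := pwPoly_fst hx
    have h3 := integral_inner_rlDeriv_sub (pwPoly_fst hu) (pwPoly_fst hz) hx1 hα1 (hg0 (i + 1)) hle
    have i1 := pwPoly_intervalIntegrable (pwPoly_inner (pwPoly_snd hu) (pwPoly_snd hx))
      (grid T r N (i + 1)) (grid T r N (i + 2))
    have i2 := pwPoly_intervalIntegrable (pwPoly_inner (pwPoly_snd hz) (pwPoly_snd hx))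
      (grid T r N (i + 1)) (grid T r N (i + 2))
    -- Since the test function is `u - z`, the two gradient terms differ by the integral of `‖∇(u -
    -- z)‖²`.
    have h4 : 0 ≤ (∫ t in grid T r N (i + 1)..grid T r N (i + 2), inner ℝ (u t).2 ((u - z) t).2) -
        ∫ t in grid T r N (i + 1)..grid T r N (i + 2), inner ℝ (z t).2 ((u - z) t).2 := by
      rw [← intervalIntegral.integral_sub i1 i2]
      refine intervalIntegral.integral_nonneg hle fun t _ => ?_
      rw [← inner_sub_left]
      exact real_inner_self_nonneg
    change ∫ t in grid T r N (i + 1)..grid T r N (i + 2),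
      inner ℝ (rlDeriv 0 α ((fun s => (u s).1) - fun s => (z s).1) t) ((u - z) t).1 ≤
      ∫ t in grid T r N (i + 1)..grid T r N (i + 2), inner ℝ (∫ s in (0 : ℝ)..grid T r N i,
        (∑ j, w j * Real.exp (-(lam j) * (t - s)) - kern (-α) (t - s)) • (z s).1) ((u - z) t).1
    simp only [add_assoc, Nat.reduceAdd] at h1 h2
    linarith

end FastDG

/-! ### Choice of the constants and conclusion. -/

theorem theorem4
    -- the continuous problem and the discretization parameters
    (α T r : ℝ) (hα0 : 0 < α) (hα1 : α < 1) (hT : 0 < T) (hr : 1 ≤ r)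
    (p m d : ℕ) (hd : 1 ≤ d)
    (Ω : Set (FastDG.Space d)) (hΩo : IsOpen Ω) (hΩb : Bornology.IsBounded Ω)
    (f : ℝ → FastDG.L2 Ω)
    (hf : MeasureTheory.MemLp f 2 (MeasureTheory.volume.restrict (Set.Ioc 0 T)))
    (u₀ : FastDG.L2 Ω)
    -- quasi-uniformity constant and the constant in `|ε̂| ≲ ε`
    (κ : ℝ) (hκ : 0 < κ) (CK : ℝ) (hCK : 0 < CK) :
    ∃ c : ℝ, 0 < c ∧ ∃ C : ℝ, 0 < C ∧
      ∀ (𝒯 : Geometry.SimplicialComplex ℝ (FastDG.Space d)),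
        FastDG.IsQuasiUniformPartition κ Ω 𝒯 →
      ∀ (N : ℕ), 1 ≤ N →
      ∀ (ε : ℝ), 0 < ε → ε ≤ c * (N : ℝ) ^ (-(r * α)) →
      ∀ (δ : ℝ), 0 < δ → δ ≤ FastDG.grid T r N 1 →
      ∀ (Q : ℕ) (w lam : Fin Q → ℝ), FastDG.IsKernelApprox α δ T (CK * ε) w lam →
      ∀ (U UF : ℝ → FastDG.FunGrad Ω),
        FastDG.IsDGSolution α T r N p (FastDG.feSpace m Ω 𝒯) f u₀ U →
        FastDG.IsFastDGSolution α T r N p (FastDG.feSpace m Ω 𝒯) f u₀ w lam U UF →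
      ∀ n : ℕ, 1 ≤ n → n ≤ N →
        (∫ t in (0 : ℝ)..FastDG.grid T r N n, ‖(U t).1 - (UF t).1‖ ^ 2 ≤
            C * (ε * FastDG.grid T r N n ^ α * FastDG.grid T r N 1 ^ (-α)) ^ 2) ∧
        ((ε * FastDG.grid T r N n ^ α * FastDG.grid T r N 1 ^ (-α)) ^ 2 ≤
            C * (ε * (n : ℝ) ^ (r * α)) ^ 2) := by
  have hβ : 0 < 1 - α := sub_pos.2 hα1
  have hk := FastDG.kern_pos hβ hT
  set R : ℝ := ‖u₀‖ ^ 2 / 2 * (∫ t in (0 : ℝ)..T, FastDG.kern (1 - α) t) +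
    (FastDG.kern (1 - α) T)⁻¹ * ∫ t in (0 : ℝ)..T, ‖f t‖ ^ 2 with hR
  have hR0 : 0 ≤ R := by
    have h1 : 0 ≤ ∫ t in (0 : ℝ)..T, FastDG.kern (1 - α) t :=
      intervalIntegral.integral_nonneg hT.le fun t ht => FastDG.kern_nonneg hβ ht.1
    have h2 : 0 ≤ ∫ t in (0 : ℝ)..T, ‖f t‖ ^ 2 :=
      intervalIntegral.integral_nonneg hT.le fun t _ => by positivity
    positivity
  set M : ℝ := R / (FastDG.kern (1 - α) T / 4) with hM
  have hM0 : 0 ≤ M := by positivity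
  -- Here `(t_n/t_1)^α = n^(rα) ≤ N^(rα)`, so `c = 1/(2K)` forces `q ≤ 1/2`. In `C`, `4 K² M` comes
  -- from `4 q² M`, with `M` the stability bound. The summand `1` makes `C ≥ 1`, which suffices for
  -- the second claim because its two squares are equal.
  refine ⟨1 / (2 * CK), by positivity, 4 * CK ^ 2 * M + 1, by positivity, ?_⟩
  intro 𝒯 _ N hN ε hε hεN δ _ hδ Q w lam hker U UF hU hF n hn hnN
  have hratio := FastDG.grid_rpow_mul_grid_one_rpow (r := r) hT hN n α
  constructor
  · obtain ⟨u, hu, hUu⟩ := FastDG.exists_pwPoly_eq hT.le hr hU.1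
    obtain ⟨z, hz, hUz⟩ := FastDG.exists_pwPoly_eq hT.le hr hF.1
    have hg0 := FastDG.grid_nonneg hT.le r N n
    have hgN := FastDG.grid_monotone hT.le hr N hnN
    have hgT : FastDG.grid T r N n ≤ T := hgN.trans_eq (FastDG.grid_self T r hN)
    have hsmall : CK * ε * (FastDG.grid T r N n ^ α * FastDG.grid T r N 1 ^ (-α)) ≤ 1 / 2 := by
      rw [hratio]
      have hNpos : (0 : ℝ) < N := by exact_mod_cast hN
      have h1 : (n : ℝ) ^ (r * α) ≤ (N : ℝ) ^ (r * α) :=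
        Real.rpow_le_rpow (by positivity) (by exact_mod_cast hnN) (by positivity)
      calc CK * ε * (n : ℝ) ^ (r * α)
          ≤ CK * (1 / (2 * CK) * (N : ℝ) ^ (-(r * α))) * (N : ℝ) ^ (r * α) := by gcongr
        _ = CK * (1 / (2 * CK)) * ((N : ℝ) ^ (-(r * α)) * (N : ℝ) ^ (r * α)) := by ring
        _ = 1 / 2 := by
          rw [← Real.rpow_add hNpos, neg_add_cancel, Real.rpow_zero]
          field_simp
    have herr := hF.error_le hU hα0 hα1 hT hr hN hδ (mul_pos hCK hε) hker hu hUu hz hUz hn hnN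
      hsmall
    have hstab := hU.norm_sq_le hα0 hα1 hT hr hN hf hu hUu
    have hUM : ∫ t in (0 : ℝ)..FastDG.grid T r N n, ‖(u t).1‖ ^ 2 ≤ M := by
      refine le_trans ?_ ((le_div_iff₀' (by positivity)).2 hstab)
      exact intervalIntegral.integral_mono_interval le_rfl hg0 hgT
        (Filter.Eventually.of_forall fun t => by positivity)
        (FastDG.pwPoly_norm_sq_intervalIntegrable (FastDG.pwPoly_fst hu) _ _)
    have hcongr : ∫ t in (0 : ℝ)..FastDG.grid T r N n, ‖(U t).1 - (UF t).1‖ ^ 2 =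
        ∫ t in (0 : ℝ)..FastDG.grid T r N n, ‖(u t).1 - (z t).1‖ ^ 2 := by
      refine intervalIntegral.integral_congr_Ioo_of_le hg0 fun t ht => ?_
      have hmem : t ∈ Set.Ioc 0 (FastDG.grid T r N N) := ⟨ht.1, ht.2.le.trans hgN⟩
      beta_reduce
      rw [hUu t hmem, hUz t hmem]
    rw [hcongr]
    calc _ ≤ _ := herr
      _ ≤ 4 * (CK * ε * (FastDG.grid T r N n ^ α * FastDG.grid T r N 1 ^ (-α))) ^ 2 * M := by
        gcongr
      _ = 4 * CK ^ 2 * M * (ε * FastDG.grid T r N n ^ α * FastDG.grid T r N 1 ^ (-α)) ^ 2 := by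
        ring
      _ ≤ _ := by
        gcongr
        linarith
  · rw [mul_assoc ε, hratio]
    refine le_mul_of_one_le_left (by positivity) ?_
    have : 0 ≤ 4 * CK ^ 2 * M := by positivity
    linarith
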